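/- Let $\mathbb M=(M,<,\dots)$ be an arbitrary o-minimal structure (an expansion of a nonempty dense linear order without endpoints in which every definable subset of $M$ is a finite union of points and open intervals with endpoints in $M\cup\{\pm\infty\}$). "Definable" means definable in $\mathbb M$ with parameters; $M$ carries the order topology and $M^m$ the product topology. A *definable group-interval* $J=\langle(-b,b),0,+,<\rangle$ is an open interval $(-b,b)\subseteq M$, with endpoints $-b<b$ in $M\cup\{\pm\infty\}$, together with an element $0\in J$ and a partial binary operation $+$ on $J$ with values in $J$, definable and continuous on its domain, such that - $x+y$ is defined iff $y+x$ is, and then $x+y=y+x$; if $x+y$ and $y+z$ are defined, then $(x+y)+z$ is defined iff $x+(y+z)$ is, and then they are equal; if $x<y$ and $x+z$, $y+z$ are defined, then $x+z<y+z$; and $x+0$ is defined and equal to $x$ for all $x\in J$; - for every $x\in J$ with $x>0$, the set $\{y\in J: y>0 \text{ and } x+y \text{ is defined}\}$ is a nonempty interval of the form $(0,r(x))$, with $\lim_{z\to 0}(x+z)=x$ and $\lim_{z\to r(x)^-}(x+z)=b$; - for every $x\in J$ there is $z\in J$ with $x+z=0$. Let $\mathbf J=\prod_{i=1}^m J_i\subseteq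 M^m$ be a cartesian product of definable group-intervals $J_i=\langle(-_ib_i,b_i),0_i,+_i,<\rangle$. Let $\mathbb J$ be the associated structure whose domain is the ordered disjoint concatenation $$(-_1b_1,b_1)\cup\{c_2\}\cup(-_2b_2,b_2)\cup\dots\cup\{c_m\}\cup(-_mb_m,b_m),$$ where $c_2,\dots,c_m$ are new points, and whose definable sets are the subsets of the finite powers of this domain which are definable in $\mathbb M$; the domain has its order topology, its powers have the product topology, and $\mathbf J$ is regarded as a subset of the $m$-th power. A subset $X\subseteq \mathbf J$ is *$\mathbb J$-definably normal* if for all disjoint $\mathbb J$-definable relatively closed subsets $Z_1,Z_2$ of $X$ there are disjoint $\mathbb J$-definable relatively open subsets $U_1,U_2$ of $X$ with $Z_1\subseteq U_1$ and $Z_2\subseteq U_2$. Then every open definable subset of $\mathbf J$ is a finite union of open definable subsets of $\mathbf J$ that are $\mathbb J$-definably normal. -/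

import Mathlib

open Set Filter Topology FirstOrder

universe u v w

/-- The open interval `(a, b)` of `M` with endpoints `a ∈ M ∪ {-∞}` and `b ∈ M ∪ {+∞}`. -/
def openInterval {M : Type w} [LinearOrder M] (a : WithBot M) (b : WithTop M) : Set M :=
  {x | a < (x : WithBot M) ∧ (x : WithTop M) < b}

/-- A set in a power of `M` is definable if it is first-order definable with parameters from `M`. -/
def IsDef (L : FirstOrder.Language.{u, v}) {M : Type w} [L.Structure M] {ι : Type*} (X : Set (ι → M)) :
    Prop :=
  (Set.univ : Set M).Definable L X

/-- The ordered structure `M` is o-minimal: every subset of `M` that is definable with parameters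
is a finite union of points and open intervals with endpoints in `M ∪ {-∞, +∞}`. -/
def IsOMinimal (L : FirstOrder.Language.{u, v}) (M : Type w) [LinearOrder M] [L.Structure M] : Prop :=
  ∀ S : Set M, (Set.univ : Set M).Definable₁ L S →
    ∃ (F : Finset M) (n : ℕ) (a : Fin n → WithBot M) (b : Fin n → WithTop M),
      S = (F : Set M) ∪ ⋃ i, openInterval (a i) (b i)

/-- A group-interval `⟨(-b, b), 0, +, <⟩` in the ordered set `M`.  The endpoints `-b`, `b` are `lo`,
`hi`; the partial operation `+` is given by its domain `dom` (the pairs `(x, y)` for which `x + y`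
is defined) and its values `op x y` for `(x, y) ∈ dom`; the values of `op` outside `dom` are
irrelevant. -/
structure GroupInterval (M : Type w) [LinearOrder M] [TopologicalSpace M] where
  lo : WithBot M
  hi : WithTop M
  zero : M
  dom : Set (M × M)
  op : M → M → M
  zero_mem : zero ∈ openInterval lo hi
  dom_subset : dom ⊆ openInterval lo hi ×ˢ openInterval lo hi
  op_mem : ∀ x y, (x, y) ∈ dom → op x y ∈ openInterval lo hi
  continuousOn_op : ContinuousOn (fun p : M × M => op p.1 p.2) dom
  op_comm : ∀ x y, (x, y) ∈ dom → (y, x) ∈ dom ∧ op x y = op y x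
  /-- `(x + y) + z = x + (y + z)`: when `x + y` and `y + z` are defined, one side is defined if
  and only if the other is, and then they are equal. -/
  op_assoc : ∀ x y z, (x, y) ∈ dom → (y, z) ∈ dom →
    (((op x y, z) ∈ dom ↔ (x, op y z) ∈ dom) ∧
      ((op x y, z) ∈ dom → op (op x y) z = op x (op y z)))
  op_lt_op : ∀ x y z, x < y → (x, z) ∈ dom → (y, z) ∈ dom → op x z < op y z
  op_zero : ∀ x ∈ openInterval lo hi, (x, zero) ∈ dom ∧ op x zero = x
  /-- For `0 < x`, the set of `0 < y` with `x + y` defined is an interval `(0, r)`, and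
  `x + z → b` as `z → r` from the left. -/
  exists_radius : ∀ x ∈ openInterval lo hi, zero < x →
    ∃ r : WithTop M, (zero : WithTop M) < r ∧
      (∀ y, zero < y → ((x, y) ∈ dom ↔ (y : WithTop M) < r)) ∧
      (∀ c : M, (c : WithTop M) < hi → ∃ d : M, zero < d ∧ (d : WithTop M) < r ∧
        ∀ z, d < z → (z : WithTop M) < r → c < op x z)
  /-- For `0 < x`, `x + z → x` as `z → 0`. -/
  tendsto_zero : ∀ x ∈ openInterval lo hi, zero < x →
    Tendsto (fun z => op x z) (𝓝[{z | (x, z) ∈ dom}] zero) (𝓝 x)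
  exists_neg : ∀ x ∈ openInterval lo hi, ∃ z, (x, z) ∈ dom ∧ op x z = zero

namespace GroupInterval

variable {M : Type w} [LinearOrder M] [TopologicalSpace M]

/-- The underlying interval `(-b, b)`. -/
def carrier (J : GroupInterval M) : Set M := openInterval J.lo J.hi

/-- A group-interval is definable if (the graph of) its partial operation is definable. -/
def IsDefinable (L : FirstOrder.Language.{u, v}) [L.Structure M] (J : GroupInterval M) : Prop :=
  IsDef L {p : Fin 3 → M | (p 0, p 1) ∈ J.dom ∧ J.op (p 0) (p 1) = p 2}

end GroupInterval

section Product

variable {M : Type w} [LinearOrder M] [TopologicalSpace M] {m : ℕ}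

/-- The cartesian product `J₁ × ⋯ × Jₘ`, as a subset of `M ^ m`. -/
def productBox (J : Fin m → GroupInterval M) : Set (Fin m → M) :=
  {p | ∀ i, p i ∈ (J i).carrier}

/-- The domain of the structure associated with `J₁ × ⋯ × Jₘ`: the ordered concatenation
`(-b₁, b₁) ∪ {c₂} ∪ (-b₂, b₂) ∪ ⋯ ∪ {cₘ} ∪ (-bₘ, bₘ)` of disjoint copies of the intervals and new
points `c₂, …, cₘ`.  The point `x` of the copy of the `i`-th interval is `(i, x)`, the new point
just below that copy (when the copy is not the first one) is `(i, ⊥)`; the order is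
lexicographic. -/
def ConcatDomain (J : Fin m → GroupInterval M) : Type w :=
  {p : Fin m ×ₗ WithBot M //
    ((ofLex p).2 = ⊥ ∧ ((ofLex p).1 : ℕ) ≠ 0) ∨
      ∃ x ∈ (J (ofLex p).1).carrier, (ofLex p).2 = (x : WithBot M)}

noncomputable instance (J : Fin m → GroupInterval M) : LinearOrder (ConcatDomain J) :=
  inferInstanceAs (LinearOrder {p : Fin m ×ₗ WithBot M //
    ((ofLex p).2 = ⊥ ∧ ((ofLex p).1 : ℕ) ≠ 0) ∨
      ∃ x ∈ (J (ofLex p).1).carrier, (ofLex p).2 = (x : WithBot M)})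

/-- The domain carries its order topology. -/
noncomputable instance (J : Fin m → GroupInterval M) : TopologicalSpace (ConcatDomain J) :=
  Preorder.topology (ConcatDomain J)

instance (J : Fin m → GroupInterval M) : OrderTopology (ConcatDomain J) := ⟨rfl⟩

/-- The definable sets of the structure induced on the concatenated domain: the sets of `k`-tuples
that are definable in the ambient structure `M`.  The domain being a finite disjoint union of
intervals of `M` and single points, this means that for every choice `s`, `C` of a piece for each
coordinate (coordinate `j` at the new point `(s j, ⊥)` if `j ∈ C`, and in the copy of the interval
with index `s j` otherwise), the part of `X` in that choice of pieces is given by a definable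
condition on the coordinates in `M`. -/
def ConcatDefinable (L : FirstOrder.Language.{u, v}) [L.Structure M] (J : Fin m → GroupInterval M) {k : ℕ}
    (X : Set (Fin k → ConcatDomain J)) : Prop :=
  ∀ (s : Fin k → Fin m) (C : Finset (Fin k)),
    IsDef L {p : Fin k → M | ∃ x ∈ X, ∀ j,
      (x j).1 = toLex (s j, if j ∈ C then (⊥ : WithBot M) else (p j : WithBot M))}

/-- A subset `V` of `J₁ × ⋯ × Jₘ`, regarded as a set of `m`-tuples of the concatenated domain (with
the `i`-th coordinate in the copy of the `i`-th interval). -/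
def toConcat (J : Fin m → GroupInterval M) (V : Set (Fin m → M)) :
    Set (Fin m → ConcatDomain J) :=
  {x | ∃ p ∈ V, ∀ i, (x i).1 = toLex (i, (p i : WithBot M))}

end Product

/-- Definable normality of a subset `X` of a topological space `E`, with respect to a notion `D` of
definable subset of `E`: disjoint definable relatively closed subsets of `X` can be separated by
disjoint definable relatively open subsets of `X`. -/
def DefinablyNormal {E : Type*} [TopologicalSpace E] (D : Set E → Prop) (X : Set E) : Prop :=
  ∀ Z₁ Z₂ : Set E, Z₁ ⊆ X → Z₂ ⊆ X → D Z₁ → D Z₂ →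
    IsClosed ((↑) ⁻¹' Z₁ : Set X) → IsClosed ((↑) ⁻¹' Z₂ : Set X) → Disjoint Z₁ Z₂ →
    ∃ U₁ U₂ : Set E, U₁ ⊆ X ∧ U₂ ⊆ X ∧ D U₁ ∧ D U₂ ∧
      IsOpen ((↑) ⁻¹' U₁ : Set X) ∧ IsOpen ((↑) ⁻¹' U₂ : Set X) ∧ Disjoint U₁ U₂ ∧
      Z₁ ⊆ U₁ ∧ Z₂ ⊆ U₂

/-- A subset `V` of `J₁ × ⋯ × Jₘ` is definably normal in the structure associated with
`J₁ × ⋯ × Jₘ`. -/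
def InducedDefinablyNormal (L : FirstOrder.Language.{u, v}) {M : Type w} [LinearOrder M] [TopologicalSpace M]
    [L.Structure M] {m : ℕ} (J : Fin m → GroupInterval M) (V : Set (Fin m → M)) : Prop :=
  DefinablyNormal (ConcatDefinable L J (k := m)) (toConcat J V)

/-!
The proof splits the coordinates of the product into classes and treats open sets that are products
over these classes.

Two indices `i`, `j` are in the same class if the right germs at the zeros of `J i` and `J j` are in
definable increasing correspondence (`GermEquiv`).

*Different classes are orthogonal.*  A definable function from an infinite subset of `J i` to `J j`
with finite fibres would, by the monotonicity theorem, restrict to a monotone bijection of intervals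
(`exists_monotone_bijection`), and translations in the two group-intervals would turn it into a
correspondence of the germs at the zeros.  So between group-intervals of different classes every
definable function on an infinite set has an infinite fibre
(`GroupInterval.hasInfiniteFibers_of_not_germEquiv`).  Since the jumps of a definable subset of the
line form a finite set, it follows that a definable family of subsets of one of the intervals
indexed by the other has only finitely many members (`HasInfiniteFibers.orthogonal`), and by
induction the same holds for boxes (`orthogonalBoxes_of_orthogonal`).  In particular a definable subset of the
whole product is a finite union of products of definable sets, one for each class.

*One class is definably normal.*  The sets `|x - y| < t` in a group-interval behave like the balls
of a metric with values in the germ at zero (`IsScale`, `GroupInterval.isScale`), and along the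
correspondence of germs the group-intervals of one class get scales over one common germ
(`GermEquiv.exists_isScale`).  The usual proof that metric spaces are normal then separates disjoint
relatively closed definable subsets of any subset of their product (`defSep_of_isScale`).

*Combination.*  An open definable `U` is a finite union of products `V` of open definable sets, one
for each class (`exists_finite_cover_by_factors`).  Disjoint relatively closed definable subsets of
such a `V` are finite unions of products of closed sets, and disjoint products are already disjoint,
hence separated, in one of the factors (`defSep_of_factors`).  The set `U` itself need not be
definably normal: the square of two orthogonal intervals with one point removed is not, as the two
punctured axes through that point cannot be separated.  Finally, separation is carried over to the
concatenated domain, in whose power the product is embedded homeomorphically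
(`inducedDefinablyNormal_of_defSep`).
-/

set_option linter.unusedSectionVars false

/-! ### Definable predicates and functions -/

section Calculus

variable (L : FirstOrder.Language.{u, v}) {M : Type w} [L.Structure M] {ι κ : Type}

/-- A predicate on tuples is definable (with parameters).  Being a class, it lets instance
resolution assemble the definability of a formula from that of its atoms. -/
class DPred (P : (ι → M) → Prop) : Prop where
  isDef : IsDef L {v | P v}

/-- A function on tuples is definable, i.e. its graph is; the value is the coordinate `inr ()`. -/
class DFun (t : (ι → M) → M) : Prop where
  isDef : IsDef L {w : ι ⊕ Unit → M | w (Sum.inr ()) = t (fun i => w (Sum.inl i))}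

/-- A binary relation on `M` is definable. -/
class DRel2 (R : M → M → Prop) : Prop where
  isDef : DPred L (fun v : Fin 2 → M => R (v 0) (v 1))

/-- A ternary relation on `M` is definable. -/
class DRel3 (R : M → M → M → Prop) : Prop where
  isDef : DPred L (fun v : Fin 3 → M => R (v 0) (v 1) (v 2))

/-- A set of tuples is definable (class version of `IsDef`). -/
class DTup (S : Set (κ → M)) : Prop where
  isDef : IsDef L S

/-- A subset of `M` is definable. -/
class DSet (S : Set M) : Prop where
  isDef : (univ : Set M).Definable₁ L S

variable {L}

theorem IsDef.dpred {S : Set (ι → M)} (h : IsDef L S) : DPred L (fun v => v ∈ S) := ⟨h⟩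

instance DPred.and {P Q : (ι → M) → Prop} [hP : DPred L P] [hQ : DPred L Q] :
    DPred L (fun v => P v ∧ Q v) := ⟨Set.Definable.inter hP.isDef hQ.isDef⟩

instance DPred.or {P Q : (ι → M) → Prop} [hP : DPred L P] [hQ : DPred L Q] :
    DPred L (fun v => P v ∨ Q v) := ⟨Set.Definable.union hP.isDef hQ.isDef⟩

instance DPred.not {P : (ι → M) → Prop} [hP : DPred L P] :
    DPred L (fun v => ¬ P v) := ⟨Set.Definable.compl hP.isDef⟩

instance DPred.imp {P Q : (ι → M) → Prop} [hP : DPred L P] [hQ : DPred L Q] :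
    DPred L (fun v => P v → Q v) := by
  simp only [imp_iff_not_or]; infer_instance

instance DPred.iff {P Q : (ι → M) → Prop} [hP : DPred L P] [hQ : DPred L Q] :
    DPred L (fun v => P v ↔ Q v) := by
  simp only [iff_def]; infer_instance

instance DPred.const {p : Prop} : DPred L (fun _ : ι → M => p) := by
  by_cases h : p
  · exact ⟨by simp [h, IsDef]⟩
  · exact ⟨by simp [h, IsDef]⟩

/-- Reindexing variables preserves definability. -/
theorem DPred.reindex {P : (ι → M) → Prop} [hP : DPred L P] (e : ι → κ) :
    DPred L (fun v : κ → M => P (fun i => v (e i))) :=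
  ⟨hP.isDef.preimage_comp e⟩

instance DPred.exists_tuple [Finite κ] {P : (ι → M) → (κ → M) → Prop}
    [h : DPred L (fun w : ι ⊕ κ → M => P (fun i => w (Sum.inl i)) (fun k => w (Sum.inr k)))] :
    DPred L (fun v => ∃ u, P v u) := ⟨Set.Definable.exists_of_finite h.isDef⟩

instance DPred.forall_tuple [Finite κ] {P : (ι → M) → (κ → M) → Prop}
    [h : DPred L (fun w : ι ⊕ κ → M => P (fun i => w (Sum.inl i)) (fun k => w (Sum.inr k)))] :
    DPred L (fun v => ∀ u, P v u) := ⟨Set.Definable.forall_of_finite h.isDef⟩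

instance DPred.exists_elem {P : (ι → M) → M → Prop}
    [h : DPred L (fun w : ι ⊕ Unit → M => P (fun i => w (Sum.inl i)) (w (Sum.inr ())))] :
    DPred L (fun v => ∃ x, P v x) := by
  have := DPred.exists_tuple (κ := Unit) (P := fun v u => P v (u ())) (h := h)
  convert! this using 3
  exact ⟨fun ⟨x, hx⟩ => ⟨fun _ => x, hx⟩, fun ⟨u, hu⟩ => ⟨u (), hu⟩⟩

instance DPred.forall_elem {P : (ι → M) → M → Prop}
    [h : DPred L (fun w : ι ⊕ Unit → M => P (fun i => w (Sum.inl i)) (w (Sum.inr ())))] :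
    DPred L (fun v => ∀ x, P v x) := by
  have := DPred.forall_tuple (κ := Unit) (P := fun v u => P v (u ())) (h := h)
  convert! this using 3
  exact ⟨fun h u => h (u ()), fun h x => h (fun _ => x)⟩

instance DPred.forall_finite [Finite κ] {P : (ι → M) → κ → Prop}
    [h : ∀ k, DPred L (fun v => P v k)] : DPred L (fun v => ∀ k, P v k) := by
  have := Set.definable_iInter_of_finite (A := univ) (L := L) (fun k => (h k).isDef)
  exact ⟨by convert! this using 1; ext; simp⟩

theorem DPred.eq_vars (i j : ι) : DPred L (fun v : ι → M => v i = v j) :=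
  ⟨⟨(FirstOrder.Language.Term.var i).equal (FirstOrder.Language.Term.var j), by
    ext; simp [FirstOrder.Language.Formula.realize_equal]⟩⟩

instance DFun.proj (i : ι) : DFun L (fun v : ι → M => v i) :=
  ⟨(DPred.eq_vars (Sum.inr ()) (Sum.inl i)).isDef⟩

instance DFun.const (c : M) : DFun L (fun _ : ι → M => c) :=
  ⟨⟨(FirstOrder.Language.Term.var (Sum.inr ())).equal
      (L.con (⟨c, mem_univ c⟩ : (univ : Set M))).term, by
    ext; simp [FirstOrder.Language.Formula.realize_equal]⟩⟩

/-- Substituting definable functions into a definable predicate. -/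
theorem DPred.comp [Finite κ] {P : (κ → M) → Prop} (hP : DPred L P) {t : κ → (ι → M) → M}
    [ht : ∀ k, DFun L (t k)] : DPred L (fun v => P (fun k => t k v)) := by
  have h : DPred L (fun v => ∃ u : κ → M, (∀ k, u k = t k v) ∧ P u) := by
    have h1 : ∀ k, DPred L (fun w : ι ⊕ κ → M => w (Sum.inr k) = t k (fun i => w (Sum.inl i))) := by
      intro k
      have := DPred.reindex (hP := (⟨(ht k).isDef⟩ : DPred L (fun w : ι ⊕ Unit → M =>
        w (Sum.inr ()) = t k (fun i => w (Sum.inl i)))))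
        (Sum.elim Sum.inl (fun _ => Sum.inr k) : ι ⊕ Unit → ι ⊕ κ)
      simpa using this
    have h2 := DPred.reindex (hP := hP) (Sum.inr : κ → ι ⊕ κ)
    infer_instance
  convert! h using 2 with v
  constructor
  · exact fun h => ⟨_, fun _ => rfl, h⟩
  · rintro ⟨u, hu, h⟩
    rwa [← funext hu]

instance DFun.sumElim {ι₁ ι₂ : Type} {f : (ι → M) → ι₁ → M} {g : (ι → M) → ι₂ → M}
    [hf : ∀ a, DFun L (fun v => f v a)] [hg : ∀ b, DFun L (fun v => g v b)] (j : ι₁ ⊕ ι₂) :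
    DFun L (fun v => Sum.elim (f v) (g v) j) := by
  cases j
  · exact hf _
  · exact hg _

instance DPred.rel2 {R : M → M → Prop} [hR : DRel2 L R] {a b : (ι → M) → M} [ha : DFun L a]
    [hb : DFun L b] : DPred L (fun v => R (a v) (b v)) := by
  have : ∀ k, DFun L ((![a, b] : Fin 2 → (ι → M) → M) k) := by
    intro k; fin_cases k <;> assumption
  exact DPred.comp hR.isDef (t := ![a, b])

instance DPred.rel3 {R : M → M → M → Prop} [hR : DRel3 L R] {a b c : (ι → M) → M} [ha : DFun L a]
    [hb : DFun L b] [hc : DFun L c] : DPred L (fun v => R (a v) (b v) (c v)) := by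
  have : ∀ k, DFun L ((![a, b, c] : Fin 3 → (ι → M) → M) k) := by
    intro k; fin_cases k <;> assumption
  exact DPred.comp hR.isDef (t := ![a, b, c])

instance DPred.mem_set {S : Set M} [hS : DSet L S] {a : (ι → M) → M} [ha : DFun L a] :
    DPred L (fun v => a v ∈ S) :=
  DPred.comp (⟨hS.isDef⟩ : DPred L (fun x : Fin 1 → M => x 0 ∈ S)) (t := fun _ => a)

instance DRel2.eq : DRel2 L (fun x y : M => x = y) := ⟨DPred.eq_vars 0 1⟩

/-- A function `M → M` is definable. -/
class DFun1 (L : FirstOrder.Language.{u, v}) {M : Type w} [L.Structure M] (f : M → M) : Prop where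
  isDef : DRel2 L (fun x y => y = f x)

instance DFun.comp1 {f : M → M} [hf : DFun1 L f] {a : (ι → M) → M} [ha : DFun L a] :
    DFun L (fun v => f (a v)) := by
  have h1 := hf.isDef
  have h3 : DPred L (fun w : (ι ⊕ Unit) ⊕ Unit → M =>
      w (Sum.inr ()) = a (fun i => w (Sum.inl (Sum.inl i)))) := by
    have := DPred.reindex (hP := (⟨ha.isDef⟩ : DPred L (fun w : ι ⊕ Unit → M =>
      w (Sum.inr ()) = a (fun i => w (Sum.inl i)))))
      (Sum.elim (fun i => Sum.inl (Sum.inl i)) Sum.inr : ι ⊕ Unit → (ι ⊕ Unit) ⊕ Unit)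
    simpa using this
  have h4 : DPred L (fun w : (ι ⊕ Unit) ⊕ Unit → M =>
      w (Sum.inl (Sum.inr ())) = f (w (Sum.inr ()))) :=
    DPred.rel2 (hR := h1) (a := fun w => w (Sum.inr ()))
  have h2 := DPred.exists_elem (L := L) (P := fun (w : ι ⊕ Unit → M) x =>
    x = a (fun i => w (Sum.inl i)) ∧ w (Sum.inr ()) = f x) (h := DPred.and (hP := h3) (hQ := h4))
  exact ⟨by simpa using h2.isDef⟩

theorem DSet.of {P : M → Prop} (h : DPred L (fun v : Fin 1 → M => P (v 0))) : DSet L {x | P x} :=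
  ⟨h.isDef⟩

theorem DRel2.of {R : M → M → Prop} (h : DPred L (fun v : Fin 2 → M => R (v 0) (v 1))) :
    DRel2 L R := ⟨h⟩

theorem DRel3.of {R : M → M → M → Prop} (h : DPred L (fun v : Fin 3 → M => R (v 0) (v 1) (v 2))) :
    DRel3 L R := ⟨h⟩

instance DPred.mem_tup [Finite κ] {S : Set (κ → M)} [hS : DTup L S] {t : (ι → M) → κ → M}
    [ht : ∀ k, DFun L (fun v => t v k)] : DPred L (fun v => t v ∈ S) :=
  DPred.comp hS.isDef.dpred (t := fun k v => t v k)

instance DPred.mem_tup_self {S : Set (κ → M)} [hS : DTup L S] : DPred L (fun v => v ∈ S) :=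
  hS.isDef.dpred

end Calculus

/-! ### Tameness of definable subsets of the line -/

/-- The consequence of o-minimality on which the whole argument rests, in a form that is symmetric
under reversal of the order: membership in a definable subset of the line only changes at finitely
many points. -/
class Tame (L : FirstOrder.Language.{u, v}) (M : Type w) [L.Structure M] [LinearOrder M] :
    Prop where
  lt : DRel2 L (fun x y : M => x < y)
  tame : ∀ S : Set M, DSet L S → ∃ F : Finset M, ∀ x y, x ≤ y → (∀ z ∈ F, z < x ∨ y < z) →
    (x ∈ S ↔ y ∈ S)

attribute [instance] Tame.lt

section Dual

variable {L : FirstOrder.Language.{u, v}} {M : Type w} [L.Structure M] [LinearOrder M]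

/-- The order dual carries the same definable sets, so each statement about right-hand sides has a
mirror image. -/
instance : L.Structure Mᵒᵈ := inferInstanceAs (L.Structure M)

instance [h : Tame L M] : Tame L Mᵒᵈ where
  lt := ⟨⟨(DPred.rel2 (L := L) (R := fun x y : M => x < y) (a := fun v : Fin 2 → M => v 1)
    (b := fun v => v 0)).isDef⟩⟩
  tame S hS := by
    obtain ⟨F, hF⟩ := h.tame S ⟨hS.isDef⟩
    exact ⟨F, fun x y hxy hz => (hF y x hxy fun z hzF => (hz z hzF).symm).symm⟩

end Dual

section Line

variable (L : FirstOrder.Language.{u, v}) {M : Type w} [L.Structure M] [LinearOrder M]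

instance DRel2.le [Tame L M] : DRel2 L (fun x y : M => x ≤ y) := by
  simp only [← not_lt]; exact .of inferInstance

theorem IsOMinimal.tame [L.IsOrdered] [L.OrderedStructure M] (hM : IsOMinimal L M) : Tame L M where
  lt := by
    have h : DRel2 L (fun x y : M => x ≤ y) := by
      refine ⟨⟨⟨((L.lhomWithConstants (univ : Set M)).onFormula
        (FirstOrder.Language.leSymb.formula₂ (FirstOrder.Language.Term.var 0)
          (FirstOrder.Language.Term.var 1))), ?_⟩⟩⟩
      ext v
      simp [FirstOrder.Language.Formula.realize_rel₂]
    simp only [← not_le]; exact .of inferInstance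
  tame S hS := by
    classical
    obtain ⟨F, n, a, b, rfl⟩ := hM S hS.isDef
    let A : Finset M := Finset.univ.biUnion fun i : Fin n => (a i).recBotCoe ∅ (fun x => {x})
    let B : Finset M := Finset.univ.biUnion fun i : Fin n => (b i).recTopCoe ∅ (fun x => {x})
    refine ⟨F ∪ A ∪ B, fun x y hxy hz => ?_⟩
    have hxF : x ∉ F := fun h => by
      have := hz x (by simp [h]); rcases this with h | h
      · exact h.false
      · exact (hxy.trans_lt h).false
    have hyF : y ∉ F := fun h => by
      have := hz y (by simp [h]); rcases this with h | h
      · exact (hxy.trans_lt h).false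
      · exact h.false
    simp only [mem_union, Finset.mem_coe, hxF, hyF, false_or, mem_iUnion, openInterval,
      mem_ofPred_eq]
    refine exists_congr fun i => and_congr ?_ ?_
    · cases h : a i using WithBot.recBotCoe with
      | bot => exact iff_of_true (WithBot.bot_lt_coe _) (WithBot.bot_lt_coe _)
      | coe c =>
        have hc : c ∈ A := Finset.mem_biUnion.2 ⟨i, Finset.mem_univ _, by rw [h]; simp⟩
        rw [WithBot.coe_lt_coe, WithBot.coe_lt_coe]
        rcases hz c (by simp [hc]) with h' | h'
        · exact iff_of_true h' (h'.trans_le hxy)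
        · exact iff_of_false (hxy.trans h'.le).not_gt h'.le.not_gt
    · cases h : b i using WithTop.recTopCoe with
      | top => exact iff_of_true (WithTop.coe_lt_top _) (WithTop.coe_lt_top _)
      | coe c =>
        have hc : c ∈ B := Finset.mem_biUnion.2 ⟨i, Finset.mem_univ _, by rw [h]; simp⟩
        rw [WithTop.coe_lt_coe, WithTop.coe_lt_coe]
        rcases hz c (by simp [hc]) with h' | h'
        · exact iff_of_false (h'.trans_le le_rfl).le.not_gt (h'.le.trans hxy).not_gt
        · exact iff_of_true (hxy.trans_lt h') h'

theorem Finset.exists_gt_forall_notMem_Ioo {M : Type*} [LinearOrder M] [NoMaxOrder M]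
    (F : Finset M) (a : M) :
    ∃ d, a < d ∧ ∀ z ∈ F, z ≤ a ∨ d ≤ z := by
  classical
  by_cases h : (F.filter (a < ·)).Nonempty
  · refine ⟨_, (Finset.mem_filter.1 (Finset.min'_mem _ h)).2, fun z hz => ?_⟩
    by_cases hza : z ≤ a
    · exact .inl hza
    · exact .inr (Finset.min'_le _ _ (Finset.mem_filter.2 ⟨hz, not_le.1 hza⟩))
  · obtain ⟨d, hd⟩ := exists_gt a
    refine ⟨d, hd, fun z hz => ?_⟩
    by_contra! h'
    exact h ⟨z, Finset.mem_filter.2 ⟨hz, h'.1⟩⟩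

variable [DenselyOrdered M] [NoMinOrder M] [NoMaxOrder M] [Tame L M]

/-- A definable set is constant just to the right of any point. -/
theorem exists_right_germ (S : Set M) (hS : DSet L S) (a : M) :
    ∃ d, a < d ∧ ((∀ x, a < x → x < d → x ∈ S) ∨ ∀ x, a < x → x < d → x ∉ S) := by
  obtain ⟨F, hF⟩ := Tame.tame S hS
  obtain ⟨d, had, hd⟩ := F.exists_gt_forall_notMem_Ioo a
  obtain ⟨e, hae, hed⟩ := exists_between had
  have key : ∀ x, a < x → x < d → (x ∈ S ↔ e ∈ S) := by
    intro x hax hxd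
    rcases le_total x e with h | h
    · exact hF x e h fun z hz => (hd z hz).imp (fun h => h.trans_lt hax) fun h => hed.trans_le h
    · exact (hF e x h fun z hz => (hd z hz).imp (fun h => h.trans_lt hae)
        fun h => hxd.trans_le h).symm
  refine ⟨d, had, ?_⟩
  by_cases he : e ∈ S
  · exact .inl fun x h1 h2 => (key x h1 h2).2 he
  · exact .inr fun x h1 h2 h3 => he ((key x h1 h2).1 h3)

/-- A definable set is constant just to the left of any point. -/
theorem exists_left_germ (S : Set M) (hS : DSet L S) (a : M) :
    ∃ d, d < a ∧ ((∀ x, d < x → x < a → x ∈ S) ∨ ∀ x, d < x → x < a → x ∉ S) := by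
  have hS' : DSet (M := Mᵒᵈ) L S := ⟨hS.isDef⟩
  obtain ⟨d, h1, h2⟩ := exists_right_germ L (M := Mᵒᵈ) S hS' a
  exact ⟨d, h1, h2.imp (fun h x h3 h4 => h x h4 h3) (fun h x h3 h4 => h x h4 h3)⟩

/-- An infinite definable set contains an interval. -/
theorem Set.Infinite.exists_Ioo {S : Set M} (h : S.Infinite) (hS : DSet L S) :
    ∃ a b, a < b ∧ ∀ x, a < x → x < b → x ∈ S := by
  obtain ⟨F, hF⟩ := Tame.tame S hS
  obtain ⟨c, hcS, hcF⟩ := h.exists_notMem_finset F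
  obtain ⟨d, hcd, hd⟩ := F.exists_gt_forall_notMem_Ioo c
  refine ⟨c, d, hcd, fun x h1 h2 => (hF c x h1.le fun z hz => ?_).1 hcS⟩
  rcases hd z hz with h | h
  · exact .inl (h.lt_of_ne fun h => hcF (h ▸ hz))
  · exact .inr (h2.trans_le h)

/-- Every interval has a subinterval inside a given definable set or its complement. -/
theorem exists_subinterval_const (S : Set M) (hS : DSet L S) {a b : M} (hab : a < b) :
    ∃ a' b', a ≤ a' ∧ a' < b' ∧ b' ≤ b ∧ ((∀ x, a' < x → x < b' → x ∈ S) ∨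
      ∀ x, a' < x → x < b' → x ∉ S) := by
  obtain ⟨d, h1, h2⟩ := exists_right_germ L S hS a
  exact ⟨a, min d b, le_rfl, lt_min h1 hab, min_le_right _ _,
    h2.imp (fun h x h3 h4 => h x h3 (h4.trans_le (min_le_left _ _)))
      (fun h x h3 h4 => h x h3 (h4.trans_le (min_le_left _ _)))⟩

/-- Definable completeness. -/
theorem exists_isLUB_of_definable (S : Set M) (hS : DSet L S) (hne : S.Nonempty)
    (hb : BddAbove S) : ∃ s, IsLUB S s := by
  classical
  let S' : Set M := {x | ∃ y, y ∈ S ∧ x ≤ y}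
  have hS' : DSet L S' := .of inferInstance
  have hub : upperBounds S' = upperBounds S := by
    ext u
    exact ⟨fun h x hx => h ⟨x, hx, le_rfl⟩, fun h x ⟨y, hy, hxy⟩ => hxy.trans (h hy)⟩
  suffices h : ∃ s, IsLUB S' s by
    obtain ⟨s, hs⟩ := h
    exact ⟨s, by rwa [IsLUB, ← hub]⟩
  rw [BddAbove, ← hub] at hb
  obtain ⟨F, hF⟩ := Tame.tame S' hS'
  obtain ⟨y, hy⟩ := hne
  by_contra! hlub
  -- below every upper bound there is one that lies in the exceptional finite set
  have step : ∀ u ∈ upperBounds S', ∃ z ∈ F, z ≤ u ∧ z ∈ upperBounds S' := by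
    intro u hu
    have huS : u ∉ S' := fun h => hlub u ⟨hu, fun v hv => hv h⟩
    have hyS : y ∈ S' := ⟨y, hy, le_rfl⟩
    by_cases hne : (F.filter (· ≤ u)).Nonempty
    · set z := (F.filter (· ≤ u)).max' hne with hz
      have hzF := Finset.mem_filter.1 (Finset.max'_mem _ hne)
      have hz1 : ∀ x, z < x → x ∉ S' := by
        intro x hzx hx
        have hxu := hu hx
        refine huS ((hF x u hxu fun t ht => ?_).1 hx)
        by_cases htu : t ≤ u
        · exact .inl ((Finset.le_max' _ _ (Finset.mem_filter.2 ⟨ht, htu⟩)).trans_lt hzx)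
        · exact .inr (not_le.1 htu)
      exact ⟨z, hzF.1, hzF.2, fun x hx => not_lt.1 fun h => hz1 x h hx⟩
    · refine absurd ((hF y u (hu hyS) fun t ht => ?_).1 hyS) huS
      by_contra! h
      exact hne ⟨t, Finset.mem_filter.2 ⟨ht, h.2⟩⟩
  obtain ⟨u, hu⟩ := hb
  obtain ⟨z, hzF, -, hz⟩ := step u hu
  have hne : (F.filter (· ∈ upperBounds S')).Nonempty := ⟨z, Finset.mem_filter.2 ⟨hzF, hz⟩⟩
  have hm := Finset.mem_filter.1 (Finset.min'_mem _ hne)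
  refine hlub _ ⟨hm.2, fun v hv => ?_⟩
  obtain ⟨z, hzF, hzv, hz⟩ := step v hv
  exact (Finset.min'_le _ _ (Finset.mem_filter.2 ⟨hzF, hz⟩)).trans hzv

/-- Definable completeness, for infima. -/
theorem exists_isGLB_of_definable (S : Set M) (hS : DSet L S) (hne : S.Nonempty)
    (hb : BddBelow S) : ∃ s, IsGLB S s :=
  exists_isLUB_of_definable L (M := Mᵒᵈ) S ⟨hS.isDef⟩ hne hb

/-- The points at which membership in `S` changes. -/
def jumps (S : Set M) : Set M :=
  {y | ¬ ∃ l r, l < y ∧ y < r ∧ ∀ z, l < z → z < r → (z ∈ S ↔ y ∈ S)}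

theorem jumps_finite (S : Set M) (hS : DSet L S) : (jumps S).Finite := by
  classical
  obtain ⟨F, hF⟩ := Tame.tame S hS
  refine F.finite_toSet.subset fun y hy => ?_
  by_contra hyF
  apply hy
  obtain ⟨r, hyr, hr⟩ := F.exists_gt_forall_notMem_Ioo y
  obtain ⟨l, hly, hl⟩ := Finset.exists_gt_forall_notMem_Ioo (M := Mᵒᵈ) F y
  refine ⟨l, r, hly, hyr, fun z hlz hzr => ?_⟩
  rcases le_total y z with h | h
  · refine (hF y z h fun t ht => ?_).symm
    rcases hr t ht with h' | h'
    · exact .inl (h'.lt_of_ne fun h => hyF (h ▸ ht))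
    · exact .inr (hzr.trans_le h')
  · refine hF z y h fun t ht => ?_
    rcases hl t ht with h' | h'
    · exact .inr (lt_of_le_of_ne h' fun h => hyF (by subst h; exact ht))
    · exact .inl (lt_of_le_of_lt h' hlz)

/-- Definable connectedness: membership in a definable set does not change on a segment without
jumps. -/
theorem mem_iff_of_no_jumps (S : Set M) (hS : DSet L S) {x y : M} (hxy : x ≤ y)
    (h : ∀ z, x ≤ z → z ≤ y → z ∉ jumps S) : x ∈ S ↔ y ∈ S := by
  let A : Set M := {t | x ≤ t ∧ t ≤ y ∧ ∀ z, x ≤ z → z ≤ t → (z ∈ S ↔ x ∈ S)}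
  have hA : DSet L A := .of inferInstance
  have hxA : x ∈ A := ⟨le_rfl, hxy, fun z h1 h2 => by rw [le_antisymm h2 h1]⟩
  obtain ⟨s, hs⟩ := exists_isLUB_of_definable L A hA ⟨x, hxA⟩ ⟨y, fun t ht => ht.2.1⟩
  have hxs : x ≤ s := hs.1 hxA
  have hsy : s ≤ y := hs.2 fun t ht => ht.2.1
  obtain ⟨l, r, hls, hsr, hlr⟩ := not_not.1 (h s hxs hsy)
  -- membership is constant from `x` up to some point of `(l, s]`, hence up to `r`
  obtain ⟨t, htA, hlt⟩ : ∃ t ∈ A, l < t := by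
    by_contra! h'
    exact (hs.2 h').not_gt hls
  have key : ∀ z, x ≤ z → z < r → (z ∈ S ↔ x ∈ S) := by
    intro z h1 h2
    rcases le_or_gt z t with h3 | h3
    · exact htA.2.2 z h1 h3
    · rw [hlr z (hlt.trans h3) h2, ← hlr t hlt ((hs.1 htA).trans_lt hsr)]
      exact htA.2.2 t htA.1 le_rfl
  rcases hsy.eq_or_lt with rfl | hlt'
  · exact (key s hxs hsr).symm
  · exfalso
    obtain ⟨w, hsw, hw⟩ := exists_between (lt_min hsr hlt')
    have hwA : w ∈ A := ⟨hxs.trans hsw.le, (hw.trans_le (min_le_right _ _)).le,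
      fun z h1 h2 => key z h1 (h2.trans_lt (hw.trans_le (min_le_left _ _)))⟩
    exact (hs.1 hwA).not_gt hsw

end Line

/-! ### Local monotonicity -/

section Monotonicity

/-- The relation `ρ` restricts to a strict linear order on the set `I`. -/
structure IsStrictLinearOn {M : Type w} (ρ : M → M → Prop) (I : Set M) : Prop where
  total : ∀ x ∈ I, ∀ y ∈ I, x ≠ y → ρ x y ∨ ρ y x
  asymm : ∀ x ∈ I, ∀ y ∈ I, ρ x y → ¬ ρ y x
  trans : ∀ x ∈ I, ∀ y ∈ I, ∀ z ∈ I, ρ x y → ρ y z → ρ x z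

theorem IsStrictLinearOn.mono {M : Type w} {ρ : M → M → Prop} {I J : Set M}
    (h : IsStrictLinearOn ρ I) (hJ : J ⊆ I) : IsStrictLinearOn ρ J :=
  ⟨fun x hx y hy => h.total x (hJ hx) y (hJ hy), fun x hx y hy => h.asymm x (hJ hx) y (hJ hy),
    fun x hx y hy z hz => h.trans x (hJ hx) y (hJ hy) z (hJ hz)⟩

theorem IsStrictLinearOn.swap {M : Type w} {ρ : M → M → Prop} {I : Set M}
    (h : IsStrictLinearOn ρ I) : IsStrictLinearOn (fun x y => ρ y x) I :=
  ⟨fun x hx y hy hxy => (h.total x hx y hy hxy).symm, fun x hx y hy => h.asymm y hy x hx,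
    fun x hx y hy z hz h1 h2 => h.trans z hz y hy x hx h2 h1⟩

/-- `x` precedes the points just to its right. -/
def RightPrec {M : Type w} [LT M] (ρ : M → M → Prop) (x : M) : Prop :=
  ∃ d, x < d ∧ ∀ y, x < y → y < d → ρ x y

/-- `x` precedes the points just to its left. -/
def LeftPrec {M : Type w} [LT M] (ρ : M → M → Prop) (x : M) : Prop :=
  ∃ d, d < x ∧ ∀ y, d < y → y < x → ρ x y

variable (L : FirstOrder.Language.{u, v}) {M : Type w} [L.Structure M] [LinearOrder M]
  [DenselyOrdered M] [NoMinOrder M] [NoMaxOrder M] [Tame L M]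

instance DRel2.swap {ρ : M → M → Prop} [DRel2 L ρ] : DRel2 L (fun x y => ρ y x) :=
  .of inferInstance

/-- If on an interval every point precedes its right neighbours and follows its left neighbours,
then the order is increasing. -/
theorem lt_imp_of_rightPrec_of_leftPrec_swap (ρ : M → M → Prop) [DRel2 L ρ] {a b : M}
    (hlin : IsStrictLinearOn ρ (Ioo a b)) (hR : ∀ x ∈ Ioo a b, RightPrec ρ x)
    (hL : ∀ x ∈ Ioo a b, LeftPrec (fun x y => ρ y x) x) :
    ∀ x ∈ Ioo a b, ∀ y ∈ Ioo a b, x < y → ρ x y := by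
  intro x hx y₀ hy₀ hxy₀
  by_contra hcon
  let A : Set M := {y | x < y ∧ y < b ∧ ∀ z, x < z → z ≤ y → ρ x z}
  have hA : DSet L A := .of inferInstance
  have hAy₀ : ∀ y ∈ A, y ≤ y₀ := fun y hy => by
    by_contra! h
    exact hcon (hy.2.2 y₀ hxy₀ h.le)
  obtain ⟨d, hxd, hd⟩ := hR x hx
  obtain ⟨e, hxe, he⟩ := exists_between (lt_min hxd hx.2)
  have heA : e ∈ A := ⟨hxe, he.trans_le (min_le_right _ _),
    fun z h1 h2 => hd z h1 (h2.trans_lt (he.trans_le (min_le_left _ _)))⟩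
  obtain ⟨s, hs⟩ := exists_isLUB_of_definable L A hA ⟨e, heA⟩ ⟨y₀, hAy₀⟩
  have hxs : x < s := hxe.trans_le (hs.1 heA)
  have hsI : s ∈ Ioo a b := ⟨hx.1.trans hxs, (hs.2 hAy₀).trans_lt hy₀.2⟩
  have hbelow : ∀ z, x < z → z < s → ρ x z := by
    intro z h1 h2
    obtain ⟨t, htA, ht⟩ : ∃ t ∈ A, z < t := by
      by_contra! h'
      exact (hs.2 h').not_gt h2
    exact htA.2.2 z h1 ht.le
  have hρs : ρ x s := by
    obtain ⟨l, hl, hl'⟩ := hL s hsI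
    obtain ⟨z, hz1, hz2⟩ := exists_between (max_lt hl hxs)
    have hxz := (le_max_right _ _).trans_lt hz1
    exact hlin.trans x hx z ⟨hx.1.trans hxz, hz2.trans hsI.2⟩ s hsI (hbelow z hxz hz2)
      (hl' z ((le_max_left _ _).trans_lt hz1) hz2)
  obtain ⟨r, hr, hr'⟩ := hR s hsI
  obtain ⟨t, hst, ht⟩ := exists_between (lt_min hr hsI.2)
  have htA : t ∈ A := by
    refine ⟨hxs.trans hst, ht.trans_le (min_le_right _ _), fun z h1 h2 => ?_⟩
    have hzb := h2.trans_lt (ht.trans_le (min_le_right _ _))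
    rcases lt_trichotomy z s with h | rfl | h
    · exact hbelow z h1 h
    · exact hρs
    · exact hlin.trans x hx s hsI z ⟨hx.1.trans h1, hzb⟩ hρs
        (hr' z h (h2.trans_lt (ht.trans_le (min_le_left _ _))))
  exact (hs.1 htA).not_gt hst

/-- If every point of an interval precedes its neighbours on both sides, then on a subinterval
every point `v` has a neighbourhood in which the points on the right of `v` precede those on its
left. -/
theorem exists_right_prec_left_of_prec (ρ : M → M → Prop) [DRel2 L ρ] {a b : M} (hab : a < b)
    (hlin : IsStrictLinearOn ρ (Ioo a b)) (hR : ∀ x ∈ Ioo a b, RightPrec ρ x)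
    (hL : ∀ x ∈ Ioo a b, LeftPrec ρ x) :
    ∃ a' b', a ≤ a' ∧ a' < b' ∧ b' ≤ b ∧ ∀ v ∈ Ioo a' b', ∃ c₁ c₂, c₁ < v ∧ v < c₂ ∧
      ∀ y z, c₁ < y → y < v → v < z → z < c₂ → ρ z y := by
  -- near `b`, no point precedes all the points between it and `b`
  obtain ⟨e, hae, heb, h1⟩ : ∃ e, a ≤ e ∧ e < b ∧ ∀ x ∈ Ioo e b, ∃ y, x < y ∧ y < b ∧ ρ y x := by
    let B : Set M := {x | ∀ y, x < y → y < b → ρ x y}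
    obtain ⟨e, heb, h⟩ := exists_left_germ L B (.of inferInstance) b
    refine ⟨max e a, le_max_right _ _, max_lt heb hab, fun x hx => ?_⟩
    have hxe := (le_max_left _ _).trans_lt hx.1
    have hxI : x ∈ Ioo a b := ⟨(le_max_right _ _).trans_lt hx.1, hx.2⟩
    rcases h with h | h
    · exfalso
      obtain ⟨l, hl, hl'⟩ := hL x hxI
      obtain ⟨y, hy1, hy2⟩ := exists_between (max_lt hl hx.1)
      have hy3 := (le_max_right _ _).trans_lt hy1
      exact hlin.asymm x hxI y ⟨(le_max_right _ _).trans_lt hy3, hy2.trans hx.2⟩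
        (hl' y ((le_max_left _ _).trans_lt hy1) hy2)
        (h y ((le_max_left _ _).trans_lt hy3) (hy2.trans hx.2) x hy2 hx.2)
    · have := h x hxe hx.2
      simp only [B, mem_ofPred_eq, not_forall] at this
      obtain ⟨y, hxy, hyb, hn⟩ := this
      exact ⟨y, hxy, hyb, (hlin.total x hxI y ⟨hxI.1.trans hxy, hyb⟩ hxy.ne).resolve_left hn⟩
  have hsub : Ioo e b ⊆ Ioo a b := Ioo_subset_Ioo_left hae
  -- every point follows all the points near `b`
  have h2 : ∀ c ∈ Ioo e b, ∃ d, c ≤ d ∧ d < b ∧ ∀ y, d < y → y < b → ρ y c := by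
    intro c hc
    obtain ⟨l, hlb, h⟩ := exists_left_germ L {y | ρ y c} (.of inferInstance) b
    rcases h with h | h
    · exact ⟨max l c, le_max_right _ _, max_lt hlb hc.2,
        fun y hy hyb => h y ((le_max_left _ _).trans_lt hy) hyb⟩
    exfalso
    let D : Set M := {d | c ≤ d ∧ d < b ∧ ∀ y, d < y → y < b → ρ c y}
    have hne : max l c ∈ D := by
      refine ⟨le_max_right _ _, max_lt hlb hc.2, fun y hy hyb => ?_⟩
      have hcy := (le_max_right _ _).trans_lt hy
      exact (hlin.total c (hsub hc) y (hsub ⟨hc.1.trans hcy, hyb⟩) hcy.ne).resolve_right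
        (h y ((le_max_left _ _).trans_lt hy) hyb)
    obtain ⟨d, hd⟩ := exists_isGLB_of_definable L D (.of inferInstance) ⟨_, hne⟩
      ⟨c, fun t ht => ht.1⟩
    have hcd : c ≤ d := hd.2 fun t ht => ht.1
    have hdb : d < b := (hd.1 hne).trans_lt (max_lt hlb hc.2)
    have hdI : d ∈ Ioo e b := ⟨hc.1.trans_le hcd, hdb⟩
    have habove : ∀ y, d < y → y < b → ρ c y := by
      intro y hdy hyb
      obtain ⟨t, htD, ht⟩ : ∃ t ∈ D, t < y := by
        by_contra! h'
        exact (hd.2 h').not_gt hdy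
      exact htD.2.2 y ht hyb
    obtain ⟨y, hdy, hyb, hρ⟩ := h1 d hdI
    have hyI : y ∈ Ioo e b := ⟨hdI.1.trans hdy, hyb⟩
    rcases hcd.eq_or_lt with rfl | hcd'
    · exact hlin.asymm _ (hsub hc) y (hsub hyI) (habove y hdy hyb) hρ
    rcases hlin.total c (hsub hc) d (hsub hdI) hcd'.ne with h' | h'
    · obtain ⟨l', hl', hl''⟩ := hL d (hsub hdI)
      obtain ⟨t, ht1, ht2⟩ := exists_between (max_lt hl' hcd')
      have hct := (le_max_right _ _).trans_lt ht1
      have htD : t ∈ D := by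
        refine ⟨hct.le, ht2.trans hdb, fun z h3 h4 => ?_⟩
        rcases lt_trichotomy z d with h5 | rfl | h5
        · exact hlin.trans c (hsub hc) d (hsub hdI) z (hsub ⟨hc.1.trans (hct.trans h3), h4⟩) h'
            (hl'' z (((le_max_left _ _).trans_lt ht1).trans h3) h5)
        · exact h'
        · exact habove z h5 h4
      exact (hd.1 htD).not_gt ht2
    · exact hlin.asymm _ (hsub hc) y (hsub hyI) (habove y hdy hyb)
        (hlin.trans y (hsub hyI) d (hsub hdI) c (hsub hc) hρ h')
  let Ψ : Set M := {v | ∃ c₁ c₂, c₁ < v ∧ v < c₂ ∧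
    ∀ y z, c₁ < y → y < v → v < z → z < c₂ → ρ z y}
  -- the first point after which everything precedes `c` lies in `Ψ`
  have h3 : ∀ c ∈ Ioo e b, ∃ β, c < β ∧ β < b ∧ β ∈ Ψ := by
    intro c hc
    obtain ⟨d₀, hd₀⟩ := h2 c hc
    let D : Set M := {d | c ≤ d ∧ d < b ∧ ∀ y, d < y → y < b → ρ y c}
    obtain ⟨β, hβ⟩ := exists_isGLB_of_definable L D (.of inferInstance) ⟨d₀, hd₀⟩
      ⟨c, fun t ht => ht.1⟩
    have hcβ : c ≤ β := hβ.2 fun t ht => ht.1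
    have hβb : β < b := (hβ.1 hd₀).trans_lt hd₀.2.1
    have habove : ∀ y, β < y → y < b → ρ y c := by
      intro y hdy hyb
      obtain ⟨t, htD, ht⟩ : ∃ t ∈ D, t < y := by
        by_contra! h'
        exact (hβ.2 h').not_gt hdy
      exact htD.2.2 y ht hyb
    have hβI : β ∈ Ioo e b := ⟨hc.1.trans_le hcβ, hβb⟩
    obtain ⟨r, hr, hr'⟩ := hR β (hsub hβI)
    obtain ⟨z, hz1, hz2⟩ := exists_between (lt_min hr hβb)
    have hzb := hz2.trans_le (min_le_right _ _)
    have hzI : z ∈ Ioo e b := ⟨hβI.1.trans hz1, hzb⟩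
    have hβz : ρ β z := hr' z hz1 (hz2.trans_le (min_le_left _ _))
    rcases hcβ.eq_or_lt with rfl | hcβ'
    · exact absurd (habove z hz1 hzb) (hlin.asymm _ (hsub hc) z (hsub hzI) hβz)
    have hβc : ρ β c := hlin.trans β (hsub hβI) z (hsub hzI) c (hsub hc) hβz (habove z hz1 hzb)
    obtain ⟨l, hlβ, h⟩ := exists_left_germ L {y | ρ y c} (.of inferInstance) β
    rcases h with h | h
    · exfalso
      obtain ⟨t, ht1, ht2⟩ := exists_between (max_lt hlβ hcβ')
      have htD : t ∈ D := by
        refine ⟨((le_max_right _ _).trans_lt ht1).le, ht2.trans hβb, fun y h3 h4 => ?_⟩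
        rcases lt_trichotomy y β with h5 | rfl | h5
        · exact h y (((le_max_left _ _).trans_lt ht1).trans h3) h5
        · exact hβc
        · exact habove y h5 h4
      exact (hβ.1 htD).not_gt ht2
    · refine ⟨β, hcβ', hβb, max l c, b, max_lt hlβ hcβ', hβb, fun y z h3 h4 h5 h6 => ?_⟩
      have hcy := (le_max_right _ _).trans_lt h3
      have hyI : y ∈ Ioo e b := ⟨hc.1.trans hcy, h4.trans hβb⟩
      exact hlin.trans z (hsub ⟨hβI.1.trans h5, h6⟩) c (hsub hc) y (hsub hyI) (habove z h5 h6)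
        ((hlin.total c (hsub hc) y (hsub hyI) hcy.ne).resolve_right
          (h y ((le_max_left _ _).trans_lt h3) h4))
  obtain ⟨l, hlb, h⟩ := exists_left_germ L Ψ (.of inferInstance) b
  refine ⟨max l e, b, hae.trans (le_max_right _ _), max_lt hlb heb, le_rfl, fun v hv => ?_⟩
  rcases h with h | h
  · exact h v ((le_max_left _ _).trans_lt hv.1) hv.2
  · obtain ⟨β, hvβ, hβb, hβ⟩ := h3 v ⟨(le_max_right _ _).trans_lt hv.1, hv.2⟩
    exact absurd hβ (h β (((le_max_left _ _).trans_lt hv.1).trans hvβ) hβb)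

/-- It is impossible that every point of an interval precedes its neighbours on both sides:
the preceding lemma and its mirror image contradict each other. -/
theorem not_forall_prec (ρ : M → M → Prop) [DRel2 L ρ] {a b : M} (hab : a < b)
    (hlin : IsStrictLinearOn ρ (Ioo a b)) (hR : ∀ x ∈ Ioo a b, RightPrec ρ x)
    (hL : ∀ x ∈ Ioo a b, LeftPrec ρ x) : False := by
  obtain ⟨a', b', haa', hab', hbb', h⟩ := exists_right_prec_left_of_prec L ρ hab hlin hR hL
  have hsub : ∀ x, b' > x → x > a' → x ∈ Ioo a b :=
    fun x h1 h2 => ⟨haa'.trans_lt h2, lt_of_lt_of_le h1 hbb'⟩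
  have hρ : DRel2 (M := Mᵒᵈ) L ρ := ⟨⟨(DRel2.isDef (L := L) (R := ρ)).isDef⟩⟩
  obtain ⟨b'', a'', h1, h2, h3, h'⟩ : ∃ b'' a'' : M, b'' ≤ b' ∧ a'' < b'' ∧ a' ≤ a'' ∧
      ∀ v, v < b'' → a'' < v → ∃ c₁ c₂, v < c₁ ∧ c₂ < v ∧
        ∀ y z, y < c₁ → v < y → z < v → c₂ < z → ρ z y := by
    obtain ⟨b'', a'', h1, h2, h3, h'⟩ := exists_right_prec_left_of_prec (M := Mᵒᵈ) L ρ
      (a := b') (b := a') hab' (hlin.mono fun x hx => hsub x hx.1 hx.2)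
      (fun x hx => by
        obtain ⟨d, hd, hd'⟩ := hL x (hsub x hx.1 hx.2)
        exact ⟨d, hd, fun y h1 h2 => hd' y h2 h1⟩)
      (fun x hx => by
        obtain ⟨d, hd, hd'⟩ := hR x (hsub x hx.1 hx.2)
        exact ⟨d, hd, fun y h1 h2 => hd' y h2 h1⟩)
    exact ⟨b'', a'', h1, h2, h3, fun v h4 h5 => h' v ⟨h4, h5⟩⟩
  obtain ⟨v, hv1, hv2⟩ := exists_between h2
  obtain ⟨c₁, c₂, hc₁, hc₂, hc⟩ := h v ⟨h3.trans_lt hv1, hv2.trans_le h1⟩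
  obtain ⟨e₂, e₁, he₂, he₁, he⟩ := h' v hv2 hv1
  obtain ⟨y, hy1, hy2⟩ := exists_between (max_lt (max_lt hc₁ he₁) (h3.trans_lt hv1))
  obtain ⟨z, hz1, hz2⟩ := exists_between (lt_min (lt_min hc₂ he₂) (hv2.trans_le h1))
  simp only [max_lt_iff, lt_min_iff] at hy1 hz2
  exact hlin.asymm z (hsub z hz2.2 (hy1.2.trans (hy2.trans hz1))) y
    (hsub y (hy2.trans (hz1.trans hz2.2)) hy1.2) (hc y z hy1.1.1 hy2 hz1 hz2.1.1)
    (he z y hz2.1.2 hz1 hy2 hy1.1.2)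

/-- A definable strict linear order on an interval agrees with `<` or with `>` on some
subinterval. -/
theorem exists_subinterval_monotone (ρ : M → M → Prop) [DRel2 L ρ] {a b : M} (hab : a < b)
    (hlin : IsStrictLinearOn ρ (Ioo a b)) :
    ∃ a' b', a ≤ a' ∧ a' < b' ∧ b' ≤ b ∧ ((∀ x ∈ Ioo a' b', ∀ y ∈ Ioo a' b', x < y → ρ x y) ∨
      ∀ x ∈ Ioo a' b', ∀ y ∈ Ioo a' b', x < y → ρ y x) := by
  obtain ⟨a₁, b₁, h1, h2, h3, hR⟩ := exists_subinterval_const L {x | RightPrec ρ x}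
    (by unfold RightPrec; exact .of inferInstance) hab
  obtain ⟨a₂, b₂, h4, h5, h6, hL⟩ := exists_subinterval_const L {x | LeftPrec ρ x}
    (by unfold LeftPrec; exact .of inferInstance) h2
  have hlin' : IsStrictLinearOn ρ (Ioo a₂ b₂) :=
    hlin.mono (Ioo_subset_Ioo (h1.trans h4) (h6.trans h3))
  refine ⟨a₂, b₂, h1.trans h4, h5, h6.trans h3, ?_⟩
  have hR' : (∀ x ∈ Ioo a₂ b₂, RightPrec ρ x) ∨
      ∀ x ∈ Ioo a₂ b₂, RightPrec (fun x y => ρ y x) x := by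
    refine hR.imp (fun h x hx => h x (h4.trans_lt hx.1) (hx.2.trans_le h6)) fun h x hx => ?_
    have hn := h x (h4.trans_lt hx.1) (hx.2.trans_le h6)
    obtain ⟨d, hxd, h'⟩ := exists_right_germ L {y | ρ x y} (.of inferInstance) x
    rcases h' with h' | h'
    · exact absurd ⟨d, hxd, h'⟩ hn
    · refine ⟨min d b₂, lt_min hxd hx.2, fun y hy1 hy2 => ?_⟩
      rw [lt_min_iff] at hy2
      exact (hlin'.total x hx y ⟨hx.1.trans hy1, hy2.2⟩ hy1.ne).resolve_left (h' y hy1 hy2.1)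
  have hL' : (∀ x ∈ Ioo a₂ b₂, LeftPrec ρ x) ∨
      ∀ x ∈ Ioo a₂ b₂, LeftPrec (fun x y => ρ y x) x := by
    refine hL.imp (fun h x hx => h x hx.1 hx.2) fun h x hx => ?_
    have hn := h x hx.1 hx.2
    obtain ⟨d, hxd, h'⟩ := exists_left_germ L {y | ρ x y} (.of inferInstance) x
    rcases h' with h' | h'
    · exact absurd ⟨d, hxd, h'⟩ hn
    · refine ⟨max d a₂, max_lt hxd hx.1, fun y hy1 hy2 => ?_⟩
      rw [max_lt_iff] at hy1
      exact (hlin'.total x hx y ⟨hy1.2, hy2.trans hx.2⟩ hy2.ne').resolve_left (h' y hy1.1 hy2)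
  rcases hR' with hR' | hR' <;> rcases hL' with hL' | hL'
  · exact (not_forall_prec L ρ h5 hlin' hR' hL').elim
  · exact .inl (lt_imp_of_rightPrec_of_leftPrec_swap L ρ hlin' hR' hL')
  · exact .inr (lt_imp_of_rightPrec_of_leftPrec_swap L (fun x y => ρ y x) hlin'.swap hR' hL')
  · exact (not_forall_prec L (fun x y => ρ y x) h5 hlin'.swap hR' hL').elim

end Monotonicity

/-! ### Orthogonality of intervals -/

section Orthogonality

variable (L : FirstOrder.Language.{u, v}) {M : Type w} [L.Structure M]

/-- Every definable function from an infinite definable subset of `D` to `C` takes some value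
infinitely often. -/
def HasInfiniteFibers (D C : Set M) : Prop :=
  ∀ (E : Set M) (f : M → M), DSet L E → DFun1 L f → E ⊆ D → E.Infinite → MapsTo f E C →
    ∃ c, {x | x ∈ E ∧ f x = c}.Infinite

/-- `C` and `D` are orthogonal: a definable family of subsets of `D` indexed by `C` has only
finitely many members. -/
def Orthogonal (C D : Set M) : Prop :=
  ∀ S : M → M → Prop, DRel2 L S → ((fun x => {y | y ∈ D ∧ S x y}) '' C).Finite

/-- Finiteness of all definable families of subsets of the box `∏ D b` indexed by the box
`∏ C a`. -/
def OrthogonalBoxes {α β : Type} (C : α → Set M) (D : β → Set M) : Prop :=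
  ∀ S : (α → M) → (β → M) → Prop,
    DPred L (fun w : α ⊕ β → M => S (fun a => w (Sum.inl a)) (fun b => w (Sum.inr b))) →
    ((fun x => {y | (∀ b, y b ∈ D b) ∧ S x y}) '' {x | ∀ a, x a ∈ C a}).Finite

/-- A definable, order-convex set without least or greatest element. -/
structure IsDefInterval [LinearOrder M] (C : Set M) : Prop where
  isDef : DSet L C
  ordConnected : C.OrdConnected
  exists_lt : ∀ x ∈ C, ∃ y ∈ C, y < x
  exists_gt : ∀ x ∈ C, ∃ y ∈ C, x < y

variable {L} in
theorem exists_definable_function [Nonempty M] {E : Set M} [hE : DSet L E] {G : M → M → Prop}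
    [hG : DRel2 L G] (h : ∀ x ∈ E, ∃ y, G x y)
    (huniq : ∀ x ∈ E, ∀ y y', G x y → G x y' → y = y') :
    ∃ f : M → M, DFun1 L f ∧ ∀ x ∈ E, G x (f x) := by
  classical
  choose g hg using h
  let c : M := Classical.arbitrary M
  refine ⟨fun x => if hx : x ∈ E then g x hx else c, ⟨?_⟩, fun x hx => by simpa [hx] using hg x hx⟩
  have : DRel2 L (fun x y => (x ∈ E ∧ G x y) ∨ (¬ x ∈ E ∧ y = c)) := .of inferInstance
  convert! this using 4 with x y
  by_cases hx : x ∈ E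
  · simp only [hx, dite_true, true_and, not_true, false_and, or_false]
    exact ⟨fun h => h ▸ hg x hx, fun h => huniq x hx _ _ h (hg x hx)⟩
  · simp [hx]

theorem Set.Finite.image_of_factor {α β γ : Type*} {s : Set α} {κ : α → β} {g : α → γ}
    (h : (κ '' s).Finite) (hg : ∀ x ∈ s, ∀ y ∈ s, κ x = κ y → g x = g y) : (g '' s).Finite := by
  rcases s.eq_empty_or_nonempty with rfl | ⟨x₀, hx₀⟩
  · simp
  classical
  refine (h.image fun b => if hb : b ∈ κ '' s then g hb.choose else g x₀).subset ?_
  rintro _ ⟨x, hx, rfl⟩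
  have hb : κ x ∈ κ '' s := ⟨x, hx, rfl⟩
  exact ⟨κ x, hb, by simp only [hb, dite_true]; exact hg _ hb.choose_spec.1 _ hx hb.choose_spec.2⟩

variable [LinearOrder M]

/-- The position of `y` with respect to a finite set `Q` of points. -/
def cutOf (Q : Set M) (y : M) : Set M × Set M := (Q ∩ Iio y, Q ∩ Iic y)

theorem finite_image_cutOf {Q : Set M} (hQ : Q.Finite) (D : Set M) : (cutOf Q '' D).Finite := by
  refine (hQ.powerset.prod hQ.powerset).subset ?_
  rintro _ ⟨y, -, rfl⟩
  exact ⟨inter_subset_left, inter_subset_left⟩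

theorem eq_or_of_cutOf_eq {Q : Set M} {x y : M} (h : cutOf Q x = cutOf Q y) (hxy : x ≤ y) :
    x = y ∨ ∀ z, x ≤ z → z ≤ y → z ∉ Q := by
  rcases hxy.eq_or_lt with rfl | hlt
  · exact .inl rfl
  refine .inr fun z h1 h2 hz => ?_
  simp only [cutOf, Prod.mk.injEq] at h
  have h3 : z ∈ Q ∩ Iic x := by rw [h.2]; exact ⟨hz, h2⟩
  have h4 : z = x := le_antisymm h3.2 h1
  subst h4
  have h5 : z ∈ Q ∩ Iio z := by rw [h.1]; exact ⟨hz, hlt⟩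
  exact lt_irrefl _ h5.2

/-- A function that is constant on segments avoiding a finite set has finitely many values. -/
theorem finite_image_of_const_off {γ : Type*} {Q C : Set M} (hQ : Q.Finite) {g : M → γ}
    (h : ∀ x ∈ C, ∀ y ∈ C, x ≤ y → (∀ z, x ≤ z → z ≤ y → z ∉ Q) → g x = g y) :
    (g '' C).Finite := by
  refine (finite_image_cutOf hQ C).image_of_factor fun x hx y hy hxy => ?_
  rcases le_total x y with hle | hle
  · rcases eq_or_of_cutOf_eq hxy hle with rfl | h'
    · rfl
    · exact h x hx y hy hle h'
  · rcases eq_or_of_cutOf_eq hxy.symm hle with rfl | h'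
    · rfl
    · exact (h y hy x hx hle h').symm

/-- There are only finitely many subsets of `D` that are constant on segments avoiding a finite
set. -/
theorem finite_subsets_const_off {Q D : Set M} (hQ : Q.Finite) :
    {A : Set M | A ⊆ D ∧ ∀ x ∈ D, ∀ y ∈ D, x ≤ y → (∀ z, x ≤ z → z ≤ y → z ∉ Q) →
      (x ∈ A ↔ y ∈ A)}.Finite := by
  refine Set.Finite.of_finite_image (f := fun A => cutOf Q '' A) ?_ ?_
  · refine (finite_image_cutOf hQ D).powerset.subset ?_
    rintro _ ⟨A, hA, rfl⟩
    exact image_mono hA.1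
  · have key : ∀ A B : Set M, A ⊆ D → (B ⊆ D ∧ ∀ x ∈ D, ∀ y ∈ D, x ≤ y →
        (∀ z, x ≤ z → z ≤ y → z ∉ Q) → (x ∈ B ↔ y ∈ B)) →
        cutOf Q '' A = cutOf Q '' B → A ⊆ B := by
      intro A B hA hB h x hx
      obtain ⟨y, hyB, hyx⟩ : cutOf Q x ∈ cutOf Q '' B := h ▸ mem_image_of_mem _ hx
      rcases le_total x y with hle | hle
      · rcases eq_or_of_cutOf_eq hyx.symm hle with rfl | h'
        · exact hyB
        · exact (hB.2 x (hA hx) y (hB.1 hyB) hle h').2 hyB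
      · rcases eq_or_of_cutOf_eq hyx hle with rfl | h'
        · exact hyB
        · exact (hB.2 y (hB.1 hyB) x (hA hx) hle h').1 hyB
    intro A hA B hB h
    exact (key A B hA.1 hB h).antisymm (key B A hB.1 hA h.symm)

variable [DenselyOrdered M] [NoMinOrder M] [NoMaxOrder M] [Tame L M]

/-- If every slice `{x | T x y}` with `y ∈ E` meets `C` at or above the point `c₀`, then some slice
`{y ∈ E | T x y}` with `x ∈ C` is infinite: the infimum of the slice, or else the supremum of its
first interval, is a definable function of `y`, hence constant on an infinite set. -/
theorem exists_infinite_slice_above {C D E : Set M} (hCD : HasInfiniteFibers L D C)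
    (hC : C.OrdConnected) (hCgt : ∀ x ∈ C, ∃ y ∈ C, x < y) [DSet L C] [DSet L E] (hED : E ⊆ D)
    (hE : E.Infinite) (T : M → M → Prop) [DRel2 L T] {c₀ : M} (hc₀ : c₀ ∈ C)
    (h : ∀ y ∈ E, ∃ x ∈ C, c₀ ≤ x ∧ T x y) : ∃ x ∈ C, {y | y ∈ E ∧ T x y}.Infinite := by
  have : Nonempty M := ⟨c₀⟩
  let G : M → M → Prop := fun y s => (∀ x, x ∈ C ∧ c₀ ≤ x ∧ T x y → s ≤ x) ∧
    ∀ s', (∀ x, x ∈ C ∧ c₀ ≤ x ∧ T x y → s' ≤ x) → s' ≤ s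
  have hG : DRel2 L G := .of inferInstance
  obtain ⟨φ, hφ, hφG⟩ := exists_definable_function (L := L) (E := E) (G := G)
    (fun y hy => by
      obtain ⟨x, hx⟩ := h y hy
      obtain ⟨s, hs⟩ := exists_isGLB_of_definable L {x | x ∈ C ∧ c₀ ≤ x ∧ T x y}
        (.of inferInstance) ⟨x, hx⟩ ⟨c₀, fun t ht => ht.2.1⟩
      exact ⟨s, fun x hx => hs.1 hx, fun s' hs' => hs.2 hs'⟩)
    (fun y _ s s' hs hs' => le_antisymm (hs'.2 s hs.1) (hs.2 s' hs'.1))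
  have hφC : MapsTo φ E C := fun y hy => by
    obtain ⟨x, hx⟩ := h y hy
    exact hC.out hc₀ hx.1 ⟨(hφG y hy).2 c₀ fun x hx => hx.2.1, (hφG y hy).1 x hx⟩
  obtain ⟨x₀, hx₀⟩ := hCD E φ inferInstance hφ hED hE hφC
  obtain ⟨y₀, hy₀⟩ := hx₀.nonempty
  have hx₀C : x₀ ∈ C := hy₀.2 ▸ hφC hy₀.1
  by_cases hfin : {y | y ∈ E ∧ T x₀ y}.Infinite
  · exact ⟨x₀, hx₀C, hfin⟩
  -- On an infinite set the infimum `x₀` is not attained, so the slice contains an interval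
  -- `(x₀, s)` with `s` depending definably on `y`, hence constant on an infinite set.
  let E' : Set M := {y | (y ∈ E ∧ φ y = x₀) ∧ ¬ T x₀ y}
  have hE'def : DSet L E' := .of inferInstance
  have hE' : E'.Infinite := by
    refine (hx₀.sdiff (not_infinite.1 hfin)).mono fun y hy => ⟨hy.1, fun h => hy.2 ⟨hy.1.1, h⟩⟩
  obtain ⟨c₁, hc₁, hx₀c₁⟩ := hCgt x₀ hx₀C
  let A : M → Set M := fun y => {x | x₀ < x ∧ x ≤ c₁ ∧ ∀ t, x₀ < t → t < x → T t y}
  have hA : ∀ y ∈ E', (A y).Nonempty := by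
    intro y hy
    obtain ⟨d, hd, h'⟩ := exists_right_germ L {x | T x y} (.of inferInstance) x₀
    rcases h' with h' | h'
    · exact ⟨min d c₁, lt_min hd hx₀c₁, min_le_right _ _,
        fun t h1 h2 => h' t h1 (h2.trans_le (min_le_left _ _))⟩
    · exfalso
      have hy' := hφG y hy.1.1
      rw [hy.1.2] at hy'
      refine hd.not_ge (hy'.2 d fun x hx => not_lt.1 fun hxd => ?_)
      rcases (hy'.1 x hx).eq_or_lt with rfl | hlt
      · exact hy.2 hx.2.2
      · exact h' x hlt hxd hx.2.2
  let G' : M → M → Prop := fun y s =>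
    (∀ x, (x₀ < x ∧ x ≤ c₁ ∧ ∀ t, x₀ < t → t < x → T t y) → x ≤ s) ∧
    ∀ s', (∀ x, (x₀ < x ∧ x ≤ c₁ ∧ ∀ t, x₀ < t → t < x → T t y) → x ≤ s') → s ≤ s'
  have hG' : DRel2 L G' := .of inferInstance
  obtain ⟨ψ, hψ, hψG⟩ := exists_definable_function (L := L) (E := E') (G := G')
    (fun y hy => by
      obtain ⟨s, hs⟩ := exists_isLUB_of_definable L (A y) (.of inferInstance) (hA y hy)
        ⟨c₁, fun t ht => ht.2.1⟩
      exact ⟨s, fun x hx => hs.1 hx, fun s' hs' => hs.2 hs'⟩)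
    (fun y _ s s' hs hs' => le_antisymm (hs.2 s' hs'.1) (hs'.2 s hs.1))
  have hψ₀ : ∀ y ∈ E', x₀ < ψ y ∧ ψ y ≤ c₁ := fun y hy => by
    obtain ⟨x, hx⟩ := hA y hy
    exact ⟨hx.1.trans_le ((hψG y hy).1 x hx), (hψG y hy).2 c₁ fun x hx => hx.2.1⟩
  obtain ⟨x₁, hx₁⟩ := hCD E' ψ inferInstance hψ (fun y hy => hED hy.1.1) hE'
    fun y hy => hC.out hx₀C hc₁ ⟨(hψ₀ y hy).1.le, (hψ₀ y hy).2⟩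
  obtain ⟨y₁, hy₁⟩ := hx₁.nonempty
  have h01 : x₀ < x₁ := hy₁.2 ▸ (hψ₀ y₁ hy₁.1).1
  obtain ⟨t, ht0, ht1⟩ := exists_between h01
  refine ⟨t, hC.out hx₀C hc₁ ⟨ht0.le, ht1.le.trans (hy₁.2 ▸ (hψ₀ y₁ hy₁.1).2)⟩,
    hx₁.mono fun y hy => ⟨hy.1.1.1, ?_⟩⟩
  by_contra hT
  refine (hψG y hy.1).2 t (fun x hx => not_lt.1 fun hlt => hT (hx.2.2 t ht0 hlt)) |>.not_gt ?_
  rw [hy.2]; exact ht1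

theorem exists_infinite_slice_below {C D E : Set M} (hCD : HasInfiniteFibers L D C)
    (hC : C.OrdConnected) (hClt : ∀ x ∈ C, ∃ y ∈ C, y < x) [hCdef : DSet L C] [hEdef : DSet L E]
    (hED : E ⊆ D) (hE : E.Infinite) (T : M → M → Prop) [hT : DRel2 L T] {c₀ : M} (hc₀ : c₀ ∈ C)
    (h : ∀ y ∈ E, ∃ x ∈ C, x ≤ c₀ ∧ T x y) : ∃ x ∈ C, {y | y ∈ E ∧ T x y}.Infinite := by
  have h1 : HasInfiniteFibers (M := Mᵒᵈ) L D C := fun E f hE hf =>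
    hCD E f ⟨hE.isDef⟩ ⟨⟨⟨hf.isDef.isDef.isDef⟩⟩⟩
  have h2 : DSet (M := Mᵒᵈ) L C := ⟨hCdef.isDef⟩
  have h3 : DSet (M := Mᵒᵈ) L E := ⟨hEdef.isDef⟩
  have h4 : DRel2 (M := Mᵒᵈ) L T := ⟨⟨hT.isDef.isDef⟩⟩
  exact exists_infinite_slice_above (M := Mᵒᵈ) L h1
    ⟨fun x hx y hy z hz => hC.out hy hx ⟨hz.2, hz.1⟩⟩ hClt hED hE T hc₀ h

/-- For a definable family `S x` of subsets of `D`, the points at which some `S x` jumps are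
finitely many, since otherwise a single `S x` would jump infinitely often.  Hence there are only
finitely many possibilities for `S x`. -/
theorem HasInfiniteFibers.orthogonal {C D : Set M} (hCD : HasInfiniteFibers L D C)
    (hC : IsDefInterval L C) (hD : IsDefInterval L D) : Orthogonal L C D := by
  intro S hS
  rcases C.eq_empty_or_nonempty with rfl | ⟨c₀, hc₀⟩
  · simp
  have := hC.isDef
  have := hD.isDef
  let T : M → M → Prop := fun x y => y ∈ D ∧ y ∈ jumps {y | S x y}
  have hT : DRel2 L T := by
    simp only [T, jumps, mem_ofPred_eq]
    exact .of inferInstance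
  have hTfin : ∀ x, {y | T x y}.Finite := fun x =>
    (jumps_finite L {y | S x y} (.of inferInstance)).subset fun y hy => hy.2
  let Q₁ : Set M := {y | y ∈ D ∧ ∃ x, x ∈ C ∧ c₀ ≤ x ∧ T x y}
  let Q₂ : Set M := {y | y ∈ D ∧ ∃ x, x ∈ C ∧ x ≤ c₀ ∧ T x y}
  have hQ₁def : DSet L Q₁ := .of inferInstance
  have hQ₂def : DSet L Q₂ := .of inferInstance
  have hQ₁ : Q₁.Finite := by
    by_contra hinf
    obtain ⟨x, -, hx⟩ := exists_infinite_slice_above L hCD hC.ordConnected hC.exists_gt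
      (E := Q₁) (fun y hy => hy.1) hinf T hc₀ (fun y hy => hy.2)
    exact hx ((hTfin x).subset fun y hy => hy.2)
  have hQ₂ : Q₂.Finite := by
    by_contra hinf
    obtain ⟨x, -, hx⟩ := exists_infinite_slice_below L hCD hC.ordConnected hC.exists_lt
      (E := Q₂) (fun y hy => hy.1) hinf T hc₀ (fun y hy => hy.2)
    exact hx ((hTfin x).subset fun y hy => hy.2)
  refine (finite_subsets_const_off (D := D) (hQ₁.union hQ₂)).subset ?_
  rintro _ ⟨x, hx, rfl⟩
  refine ⟨fun y hy => hy.1, fun y hy y' hy' hle hno => ?_⟩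
  simp only [mem_ofPred_eq, hy, hy', true_and]
  refine mem_iff_of_no_jumps L {y | S x y} (.of inferInstance) hle fun z h1 h2 hz => ?_
  have hzD := hD.ordConnected.out hy hy' ⟨h1, h2⟩
  refine hno z h1 h2 ?_
  rcases le_total c₀ x with h | h
  · exact .inl ⟨hzD, x, hx, h, hzD, hz⟩
  · exact .inr ⟨hzD, x, hx, h, hzD, hz⟩

end Orthogonality

/-! ### Orthogonality of boxes -/

section Boxes

variable {L : FirstOrder.Language.{u, v}} {M : Type w} [L.Structure M]

instance DFun.optionElim {ι β : Type} {t : (ι → M) → M} {y : (ι → M) → β → M}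
    [ht : DFun L t] [hy : ∀ b, DFun L (fun v => y v b)] (o : Option β) :
    DFun L (fun v => o.elim (t v) (y v)) := by
  cases o
  · exact ht
  · exact hy _

/-- A definable predicate on pairs of tuples, applied to definable tuples. -/
theorem DPred.comp_sum {ι α β : Type} [Finite α] [Finite β] {S : (α → M) → (β → M) → Prop}
    (hS : DPred L (fun w : α ⊕ β → M => S (fun a => w (Sum.inl a)) (fun b => w (Sum.inr b))))
    {x : (ι → M) → α → M} {y : (ι → M) → β → M} [∀ a, DFun L (fun v => x v a)]
    [∀ b, DFun L (fun v => y v b)] : DPred L (fun v => S (x v) (y v)) :=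
  DPred.comp hS (t := fun k v => Sum.elim (x v) (y v) k)

theorem OrthogonalBoxes.of_equiv {α β β' : Type} (e : β ≃ β')
    {C : α → Set M} {D : β' → Set M} (h : OrthogonalBoxes L C (fun b => D (e b))) :
    OrthogonalBoxes L C D := by
  intro S hS
  have h1 := h (fun x y => S x (fun b' => y (e.symm b'))) (DPred.reindex (hP := hS)
    (Sum.map id e.symm))
  refine h1.image_of_factor (κ := fun x => {y : β → M | (∀ b, y b ∈ D (e b)) ∧
    S x (fun b' => y (e.symm b'))}) fun x _ x' _ hxx' => ?_
  ext y
  have h2 := Set.ext_iff.1 hxx' (fun b => y (e b))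
  simp only [mem_ofPred_eq, Equiv.apply_symm_apply] at h2
  have h3 : (∀ b, y (e b) ∈ D (e b)) ↔ ∀ b', y b' ∈ D b' :=
    ⟨fun h b' => by simpa using h (e.symm b'), fun h b => h (e b)⟩
  rwa [h3] at h2

variable [LinearOrder M] [DenselyOrdered M] [NoMinOrder M] [NoMaxOrder M] [Tame L M]

/-- The relation between points of `M` of having the same fibre in `S` over the box of the
coordinates `β`, once the remaining coordinate is fixed to be `t`. -/
def SameFiber {α β : Type} (D : β → Set M) (S : (α → M) → (Option β → M) → Prop) (t : M)
    (x x' : α → M) : Prop :=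
  ∀ y : β → M, (∀ b, y b ∈ D b) → (S x (fun o => o.elim t y) ↔ S x' (fun o => o.elim t y))

theorem SameFiber.dpred {ι α β : Type} [Finite α] [Finite β] {D : β → Set M}
    (hD : ∀ b, DSet L (D b)) {S : (α → M) → (Option β → M) → Prop}
    (hS : DPred L (fun w : α ⊕ Option β → M => S (fun a => w (Sum.inl a)) (fun b => w (Sum.inr b))))
    {t : (ι → M) → M} {x x' : (ι → M) → α → M} [ht : DFun L t] [hx : ∀ a, DFun L (fun v => x v a)]
    [hx' : ∀ a, DFun L (fun v => x' v a)] :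
    DPred L (fun v => SameFiber D S (t v) (x v) (x' v)) := by
  have h1 : ∀ x : (ι → M) → α → M, (∀ a, DFun L (fun v => x v a)) →
      DPred L (fun w : ι ⊕ β → M => S (x (fun i => w (Sum.inl i)))
        (fun o => o.elim (t (fun i => w (Sum.inl i))) (fun b => w (Sum.inr b)))) := by
    intro x hx
    have h2 : ∀ f : (ι → M) → M, DFun L f → DFun L (fun w : ι ⊕ β → M =>
        f (fun i => w (Sum.inl i))) := by
      intro f hf
      have := DPred.reindex (hP := (⟨hf.isDef⟩ : DPred L (fun w : ι ⊕ Unit → M =>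
        w (Sum.inr ()) = f (fun i => w (Sum.inl i)))))
        (Sum.elim (fun i => Sum.inl (Sum.inl i)) Sum.inr : ι ⊕ Unit → (ι ⊕ β) ⊕ Unit)
      exact ⟨by simpa using this.isDef⟩
    have := h2 t ht
    have := fun a => h2 _ (hx a)
    exact DPred.comp_sum hS (x := fun w a => x (fun i => w (Sum.inl i)) a)
      (y := fun w o => o.elim (t (fun i => w (Sum.inl i))) (fun b => w (Sum.inr b)))
  have h3 := h1 x hx
  have h4 := h1 x' hx'
  exact DPred.forall_tuple (P := fun v y => (∀ b, y b ∈ D b) →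
    (S (x v) (fun o => o.elim (t v) y) ↔ S (x' v) (fun o => o.elim (t v) y)))

theorem fiber_eq_of_sameFiber {α β : Type} {D : Option β → Set M}
    {S : (α → M) → (Option β → M) → Prop} {x x' : α → M}
    (h : ∀ t ∈ D none, SameFiber (fun b => D (some b)) S t x x') :
    {y | (∀ b, y b ∈ D b) ∧ S x y} = {y | (∀ b, y b ∈ D b) ∧ S x' y} := by
  ext y
  refine and_congr_right fun hy => ?_
  have h1 := h (y none) (hy none) (fun b => y (some b)) fun b => hy (some b)
  have h2 : (fun o : Option β => o.elim (y none) fun b => y (some b)) = y := by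
    funext o; cases o <;> rfl
  rwa [h2] at h1

theorem sameFiber_iff_fiber_eq {α β : Type} {D : β → Set M}
    {S : (α → M) → (Option β → M) → Prop} {t : M} {x x' : α → M} :
    SameFiber D S t x x' ↔ {y : β → M | (∀ b, y b ∈ D b) ∧ S x (fun o => o.elim t y)} =
      {y : β → M | (∀ b, y b ∈ D b) ∧ S x' (fun o => o.elim t y)} := by
  constructor
  · intro h
    ext y
    exact and_congr_right fun hy => h y hy
  · intro h y hy
    have := Set.ext_iff.1 h y
    simpa [hy] using this

theorem orthogonalBoxes_of_isEmpty {α β : Type} [IsEmpty β] (C : α → Set M) (D : β → Set M) :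
    OrthogonalBoxes L C D := by
  intro S _
  exact Set.toFinite _

/-- An interval is orthogonal to a box if it is orthogonal to all its sides.  In the induction step,
for each value `t` of the additional coordinate the classes of `SameFiber` have finitely many
jumps; by orthogonality these finite sets are finitely many. -/
theorem orthogonalBoxes_of_interval {C : Set M} (hC : IsDefInterval L C) {β : Type} [Finite β] :
    ∀ D : β → Set M, (∀ b, DSet L (D b)) → (∀ b, Orthogonal L (D b) C) →
      OrthogonalBoxes L (fun _ : Unit => C) D := by
  induction β using Finite.induction_empty_option with
  | of_equiv e ih =>
    exact fun D hD hDC => OrthogonalBoxes.of_equiv e (ih _ (fun b => hD _) fun b => hDC _)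
  | h_empty => exact fun D _ _ => orthogonalBoxes_of_isEmpty _ D
  | h_option ih =>
    rename_i β _
    intro D hD hDC S hS
    have := hC.isDef
    have := hD none
    let E : M → M → M → Prop := fun t x x' =>
      SameFiber (fun b => D (some b)) S t (fun _ => x) (fun _ => x')
    have hE : DRel3 L E := .of (SameFiber.dpred (fun b => hD _) hS
      (t := fun v => v 0) (x := fun v _ => v 1) (x' := fun v _ => v 2))
    have hErefl : ∀ t x, E t x x := fun t x y _ => Iff.rfl
    let F : M → M → Prop := fun t x => x ∈ C ∧ ¬ ∃ l r, l < x ∧ x < r ∧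
      ∀ z, l < z → z < r → z ∈ C → E t z x
    have hF : DRel2 L F := .of inferInstance
    have hFfin : ∀ t, {x | F t x}.Finite := by
      intro t
      have hcl : ((fun x => {z | z ∈ C ∧ E t z x}) '' C).Finite := by
        have h1 := ih (fun b => D (some b)) (fun b => hD _) (fun b => hDC _)
          (fun x y => S x (fun o => o.elim t y)) (DPred.comp_sum hS
            (x := fun w a => w (Sum.inl a)) (y := fun w o => o.elim t (fun b => w (Sum.inr b))))
        refine Set.Finite.image_of_factor (κ := fun x => {y : β → M | (∀ b, y b ∈ D (some b)) ∧
          S (fun _ => x) (fun o => o.elim t y)}) (h1.subset ?_) ?_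
        · rintro _ ⟨x, hx, rfl⟩
          exact ⟨fun _ => x, fun _ => hx, rfl⟩
        · intro x _ x' _ hxx'
          ext z
          refine and_congr_right fun _ => ?_
          simp only [E, sameFiber_iff_fiber_eq]
          rw [show _ = _ from hxx']
      refine ((hcl.biUnion (t := fun K : Set M => jumps K) ?_)).subset ?_
      · rintro _ ⟨x, hx, rfl⟩
        exact jumps_finite L _ (.of inferInstance)
      · rintro x ⟨hx, hno⟩
        refine mem_biUnion (mem_image_of_mem _ hx) fun ⟨l, r, hl, hr, h⟩ => hno ⟨l, r, hl, hr, ?_⟩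
        exact fun z h1 h2 _ => ((h z h1 h2).2 ⟨hx, hErefl t x⟩).2
    let Q : Set M := {x | ∃ t ∈ D none, F t x}
    have hQ : Q.Finite := by
      have h1 := hDC none F hF
      refine (Set.Finite.sUnion h1 ?_).subset ?_
      · rintro _ ⟨t, -, rfl⟩
        exact (hFfin t).subset fun x hx => hx.2
      · rintro x ⟨t, ht, hx⟩
        exact ⟨_, mem_image_of_mem _ ht, hx.1, hx⟩
    have key := finite_image_of_const_off (C := C) hQ
      (g := fun x => {y : Option β → M | (∀ b, y b ∈ D b) ∧ S (fun _ => x) y}) ?_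
    · refine key.subset ?_
      rintro _ ⟨x, hx, rfl⟩
      exact ⟨x (), hx (), rfl⟩
    intro x hx x' hx' hle hno
    refine fiber_eq_of_sameFiber fun t ht => ?_
    have h1 := mem_iff_of_no_jumps L {z | z ∈ C ∧ E t z x} (.of inferInstance) hle ?_
    · have := (h1.1 ⟨hx, hErefl t x⟩).2
      exact fun y hy => (this y hy).symm
    intro z h1 h2 hz
    have hzC := hC.ordConnected.out hx hx' ⟨h1, h2⟩
    have hzF : ¬ F t z := fun h => hno z h1 h2 ⟨t, ht, h⟩
    simp only [F, hzC, true_and, not_not] at hzF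
    obtain ⟨l, r, hl, hr, h⟩ := hzF
    obtain ⟨l', hl'C, hl'⟩ := hC.exists_lt z hzC
    obtain ⟨r', hr'C, hr'⟩ := hC.exists_gt z hzC
    refine hz ⟨max l l', min r r', max_lt hl hl', lt_min hr hr', fun u hu1 hu2 => ?_⟩
    rw [max_lt_iff] at hu1
    rw [lt_min_iff] at hu2
    have huC : u ∈ C := hC.ordConnected.out hl'C hr'C ⟨hu1.2.le, hu2.2.le⟩
    have huz := h u hu1.1 hu2.1 huC
    simp only [mem_ofPred_eq, huC, hzC, true_and]
    exact forall₂_congr fun y hy => by rw [huz y hy]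

/-- Two boxes are orthogonal if all sides of the first are orthogonal to all sides of the second.
In the induction step, the equivalence relations `SameFiber` are only finitely many, by
orthogonality of the additional side to the square of the first box, and each of them has finitely
many classes. -/
theorem orthogonalBoxes_of_orthogonal {α β : Type} [Finite α] [Finite β] {C : α → Set M}
    (hC : ∀ a, DSet L (C a)) :
    ∀ D : β → Set M, (∀ b, IsDefInterval L (D b)) → (∀ a b, Orthogonal L (C a) (D b)) →
      OrthogonalBoxes L C D := by
  induction β using Finite.induction_empty_option with
  | of_equiv e ih =>
    exact fun D hD hDC => OrthogonalBoxes.of_equiv e (ih _ (fun b => hD _) fun a b => hDC a _)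
  | h_empty => exact fun D _ _ => orthogonalBoxes_of_isEmpty _ D
  | h_option ih =>
    rename_i β _
    intro D hD hDC S hS
    have h1 := orthogonalBoxes_of_interval (hD none) (β := α ⊕ α) (Sum.elim C C)
      (by rintro (a | a) <;> exact hC a) (by rintro (a | a) <;> exact hDC a none)
      (fun t w => SameFiber (fun b => D (some b)) S (t ()) (fun a => w (Sum.inl a))
        (fun a => w (Sum.inr a)))
      (SameFiber.dpred (fun b => (hD _).isDef) hS (t := fun v => v (Sum.inl ()))
        (x := fun v a => v (Sum.inr (Sum.inl a))) (x' := fun v a => v (Sum.inr (Sum.inr a))))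
    -- finitely many representatives of the values of the additional coordinate
    obtain ⟨R, hRD, hRfin, hR⟩ := exists_subset_image_finite_and.1 ⟨_, Subset.rfl, h1, rfl⟩
    refine Set.Finite.image_of_factor (κ := fun x => fun t : R =>
      {y : β → M | (∀ b, y b ∈ D (some b)) ∧ S x (fun o => o.elim ((t : Unit → M) ()) y)}) ?_ ?_
    · have := hRfin.to_subtype
      refine (Set.Finite.pi (t := fun t : R => (fun x => {y : β → M | (∀ b, y b ∈ D (some b)) ∧
        S x (fun o => o.elim ((t : Unit → M) ()) y)}) '' {x | ∀ a, x a ∈ C a})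
        fun t => ?_).subset ?_
      · exact ih (fun b => D (some b)) (fun b => hD _) (fun a b => hDC a _)
          (fun x y => S x (fun o => o.elim ((t : Unit → M) ()) y)) (DPred.comp_sum hS
            (x := fun w a => w (Sum.inl a))
            (y := fun w o => o.elim ((t : Unit → M) ()) (fun b => w (Sum.inr b))))
      · rintro _ ⟨x, hx, rfl⟩ t -
        exact ⟨x, hx, rfl⟩
    · intro x hx x' hx' hxx'
      refine fiber_eq_of_sameFiber fun t ht => ?_
      obtain ⟨t', ht'R, ht'⟩ := hR.symm ▸ mem_image_of_mem (fun t : Unit → M =>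
        {w : α ⊕ α → M | (∀ b, w b ∈ Sum.elim C C b) ∧ SameFiber (fun b => D (some b)) S (t ())
          (fun a => w (Sum.inl a)) (fun a => w (Sum.inr a))})
        (show (fun _ => t) ∈ {x : Unit → M | ∀ _ : Unit, x () ∈ D none} from fun _ => ht)
      have h2 := Set.ext_iff.1 ht' (Sum.elim x x')
      have h3 : ∀ b, Sum.elim x x' b ∈ Sum.elim C C b := by
        rintro (a | a)
        · exact hx a
        · exact hx' a
      simp only [mem_ofPred_eq, h3, implies_true, true_and, Sum.elim_inl, Sum.elim_inr] at h2
      exact h2.1 (sameFiber_iff_fiber_eq.2 (congrFun hxx' ⟨t', ht'R⟩))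

end Boxes

/-! ### Comparison of germs -/

section Germs

variable (L : FirstOrder.Language.{u, v}) {M : Type w} [L.Structure M] [LinearOrder M]

/-- The right germs of `M` at `z` and `z'` are in definable, increasing correspondence.  The
correspondence `Θ` is only required to relate points arbitrarily close to `z` and `z'`. -/
def GermEquiv (z z' : M) : Prop :=
  ∃ Θ : M → M → Prop, DRel2 L Θ ∧ (∀ s s', Θ s s' → z < s ∧ z' < s') ∧
    (∀ s s' t t', Θ s s' → Θ t t' → (s < t ↔ s' < t')) ∧
    ∀ e e', z < e → z' < e' → ∃ s s', Θ s s' ∧ s < e ∧ s' < e'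

variable [DenselyOrdered M] [NoMinOrder M] [NoMaxOrder M] [Tame L M]

theorem GermEquiv.refl (z : M) : GermEquiv L z z := by
  refine ⟨fun s s' => s = s' ∧ z < s, .of inferInstance, ?_, ?_, ?_⟩
  · rintro s _ ⟨rfl, h⟩
    exact ⟨h, h⟩
  · rintro s _ t _ ⟨rfl, -⟩ ⟨rfl, -⟩
    exact Iff.rfl
  · intro e e' he he'
    obtain ⟨s, h1, h2⟩ := exists_between (lt_min he he')
    exact ⟨s, s, ⟨rfl, h1⟩, h2.trans_le (min_le_left _ _), h2.trans_le (min_le_right _ _)⟩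

variable {L}

theorem GermEquiv.symm {z z' : M} (h : GermEquiv L z z') : GermEquiv L z' z := by
  obtain ⟨Θ, hΘ, h1, h2, h3⟩ := h
  refine ⟨fun s s' => Θ s' s, .of inferInstance, fun s s' h => (h1 s' s h).symm,
    fun s s' t t' hs ht => (h2 s' s t' t hs ht).symm, fun e e' he he' => ?_⟩
  obtain ⟨s, s', h, hs, hs'⟩ := h3 e' e he' he
  exact ⟨s', s, h, hs', hs⟩

theorem GermEquiv.trans {z z' z'' : M} (h : GermEquiv L z z') (h' : GermEquiv L z' z'') :
    GermEquiv L z z'' := by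
  obtain ⟨Θ, hΘ, h1, h2, h3⟩ := h
  obtain ⟨Θ', hΘ', h1', h2', h3'⟩ := h'
  refine ⟨fun s s'' => ∃ s', Θ s s' ∧ Θ' s' s'', .of inferInstance, ?_, ?_, ?_⟩
  · rintro s s'' ⟨s', hs, hs'⟩
    exact ⟨(h1 _ _ hs).1, (h1' _ _ hs').2⟩
  · rintro s s'' t t'' ⟨s', hs, hs'⟩ ⟨t', ht, ht'⟩
    exact (h2 _ _ _ _ hs ht).trans (h2' _ _ _ _ hs' ht')
  · intro e e'' he he''
    obtain ⟨b, hb⟩ := exists_gt z'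
    obtain ⟨s₁, s₁', hs₁, hs₁e, -⟩ := h3 e b he hb
    obtain ⟨s₂', s₂'', hs₂, -, hs₂e⟩ := h3' b e'' hb he''
    -- by o-minimality both correspondences are total near `z'`
    obtain ⟨d, hd, hd'⟩ : ∃ d, z' < d ∧ ∀ s', z' < s' → s' < d → ∃ s, Θ s s' := by
      obtain ⟨d, hd, h | h⟩ := exists_right_germ L {s' | ∃ s, Θ s s'} (.of inferInstance) z'
      · exact ⟨d, hd, h⟩
      · obtain ⟨s, s', h5, -, h6⟩ := h3 e d he hd
        exact absurd ⟨s, h5⟩ (h s' (h1 _ _ h5).2 h6)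
    obtain ⟨c, hc, hc'⟩ : ∃ d, z' < d ∧ ∀ s', z' < s' → s' < d → ∃ s'', Θ' s' s'' := by
      obtain ⟨d, hd, h | h⟩ := exists_right_germ L {s' | ∃ s'', Θ' s' s''} (.of inferInstance) z'
      · exact ⟨d, hd, h⟩
      · obtain ⟨s', s'', h5, h6, -⟩ := h3' d e'' hd he''
        exact absurd ⟨s'', h5⟩ (h s' (h1' _ _ h5).1 h6)
    obtain ⟨s', hs1, hs2⟩ := exists_between
      (lt_min (lt_min hd hc) (lt_min (h1 _ _ hs₁).2 (h1' _ _ hs₂).1))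
    simp only [lt_min_iff] at hs2
    obtain ⟨s, hs⟩ := hd' s' hs1 hs2.1.1
    obtain ⟨s'', hs'⟩ := hc' s' hs1 hs2.1.2
    exact ⟨s, s'', ⟨s', hs, hs'⟩, ((h2 _ _ _ _ hs hs₁).2 hs2.2.1).trans hs₁e,
      ((h2' _ _ _ _ hs' hs₂).1 hs2.2.2).trans hs₂e⟩

variable (L)

/-- A definable function with finite fibres on an infinite definable set restricts to a monotone
bijection between two intervals. -/
theorem exists_monotone_bijection {E : Set M} [DSet L E] (hE : E.Infinite) {f : M → M} [DFun1 L f]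
    (hf : ∀ c, {x | x ∈ E ∧ f x = c}.Finite) :
    ∃ p q u v, p < q ∧ u < v ∧ Ioo p q ⊆ E ∧ f '' Ioo p q = Ioo u v ∧
      (StrictMonoOn f (Ioo p q) ∨ StrictAntiOn f (Ioo p q)) := by
  -- the least points of the fibres
  let E' : Set M := {x | x ∈ E ∧ ∀ x', x' ∈ E → f x' = f x → x ≤ x'}
  have hE'def : DSet L E' := .of inferInstance
  have hinj : InjOn f E' := fun x hx y hy hxy =>
    le_antisymm (hx.2 y hy.1 hxy.symm) (hy.2 x hx.1 hxy)
  have hE' : E'.Infinite := by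
    intro hfin
    refine hE ((hfin.biUnion fun x _ => hf (f x)).subset fun y hy => ?_)
    obtain ⟨x, hx, hmin⟩ := Set.exists_min_image {x | x ∈ E ∧ f x = f y} id (hf (f y)) ⟨y, hy, rfl⟩
    exact mem_biUnion (show x ∈ E' from ⟨hx.1, fun x' hx' h => hmin x' ⟨hx', h.trans hx.2⟩⟩)
      ⟨hy, hx.2.symm⟩
  obtain ⟨a, b, hab, h⟩ := hE'.exists_Ioo L hE'def
  have hsub : Ioo a b ⊆ E' := fun x hx => h x hx.1 hx.2
  have hρ : DRel2 L (fun x y => f x < f y) := .of inferInstance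
  obtain ⟨a', b', h1, h2, h3, hmon⟩ := exists_subinterval_monotone L (fun x y => f x < f y) hab
    ⟨fun x hx y hy hxy => lt_or_gt_of_ne fun h => hxy (hinj (hsub hx) (hsub hy) h),
      fun x _ y _ => lt_asymm, fun x _ y _ z _ => lt_trans⟩
  have hsub' : Ioo a' b' ⊆ E' := (Ioo_subset_Ioo h1 h3).trans hsub
  have himg : {y | ∃ x, (a' < x ∧ x < b') ∧ f x = y}.Infinite :=
    (Ioo_infinite h2).image (hinj.mono hsub')
  obtain ⟨u₀, v₀, huv₀, huv⟩ := himg.exists_Ioo L (.of inferInstance)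
  obtain ⟨u, hu1, hu2⟩ := exists_between huv₀
  obtain ⟨v, hv1, hv2⟩ := exists_between hu2
  obtain ⟨x, hx, rfl⟩ := huv u hu1 hu2
  obtain ⟨y, hy, rfl⟩ := huv v (hu1.trans hv1) hv2
  rcases hmon with hmon | hmon
  · have hmon' : StrictMonoOn f (Ioo a' b') := fun x hx y hy => hmon x hx y hy
    have hxy := (hmon'.lt_iff_lt hx hy).1 hv1
    have hsub'' : Ioo x y ⊆ Ioo a' b' := Ioo_subset_Ioo hx.1.le hy.2.le
    refine ⟨x, y, f x, f y, hxy, hv1, (hsub''.trans hsub').trans fun _ h => h.1, ?_,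
      .inl (hmon'.mono hsub'')⟩
    ext z
    constructor
    · rintro ⟨w, hw, rfl⟩
      exact ⟨hmon' hx (hsub'' hw) hw.1, hmon' (hsub'' hw) hy hw.2⟩
    · intro hz
      obtain ⟨w, hw, rfl⟩ := huv z (hu1.trans hz.1) (hz.2.trans hv2)
      exact ⟨w, ⟨(hmon'.lt_iff_lt hx hw).1 hz.1, (hmon'.lt_iff_lt hw hy).1 hz.2⟩, rfl⟩
  · have hmon' : StrictAntiOn f (Ioo a' b') := fun x hx y hy => hmon x hx y hy
    have hxy := (hmon'.lt_iff_gt hx hy).1 hv1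
    have hsub'' : Ioo y x ⊆ Ioo a' b' := Ioo_subset_Ioo hy.1.le hx.2.le
    refine ⟨y, x, f x, f y, hxy, hv1, (hsub''.trans hsub').trans fun _ h => h.1, ?_,
      .inr (hmon'.mono hsub'')⟩
    ext z
    constructor
    · rintro ⟨w, hw, rfl⟩
      exact ⟨hmon' (hsub'' hw) hx hw.2, hmon' hy (hsub'' hw) hw.1⟩
    · intro hz
      obtain ⟨w, hw, rfl⟩ := huv z (hu1.trans hz.1) (hz.2.trans hv2)
      exact ⟨w, ⟨(hmon'.lt_iff_gt hw hy).1 hz.2, (hmon'.lt_iff_gt hx hw).1 hz.1⟩, rfl⟩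

end Germs

/-! ### Group-intervals -/

namespace GroupInterval

section Arithmetic

variable {M : Type w} [LinearOrder M] [TopologicalSpace M] (J : GroupInterval M)

/-- `x + y` is defined and equal to `z`. -/
def Add (x y z : M) : Prop := (x, y) ∈ J.dom ∧ J.op x y = z

variable {J}

theorem mem_of_dom {x y : M} (h : (x, y) ∈ J.dom) : x ∈ J.carrier ∧ y ∈ J.carrier :=
  J.dom_subset h

theorem zero_mem' : J.zero ∈ J.carrier := J.zero_mem

theorem ordConnected_carrier : J.carrier.OrdConnected :=
  ⟨fun _ hx _ hy _ hz => ⟨hx.1.trans_le (WithBot.coe_le_coe.2 hz.1),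
    (WithTop.coe_le_coe.2 hz.2).trans_lt hy.2⟩⟩

theorem dom_swap {x y : M} (h : (x, y) ∈ J.dom) : (y, x) ∈ J.dom := (J.op_comm x y h).1

theorem zero_dom {x : M} (hx : x ∈ J.carrier) : (J.zero, x) ∈ J.dom ∧ J.op J.zero x = x := by
  have h := J.op_zero x hx
  have h' := J.op_comm _ _ h.1
  exact ⟨h'.1, h'.2.symm.trans h.2⟩

theorem op_lt_op_left {x y z : M} (h : y < z) (hy : (x, y) ∈ J.dom) (hz : (x, z) ∈ J.dom) :
    J.op x y < J.op x z := by
  rw [(J.op_comm _ _ hy).2, (J.op_comm _ _ hz).2]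
  exact J.op_lt_op _ _ _ h (dom_swap hy) (dom_swap hz)

theorem op_le_op_left {x y z : M} (h : y ≤ z) (hy : (x, y) ∈ J.dom) (hz : (x, z) ∈ J.dom) :
    J.op x y ≤ J.op x z := by
  rcases h.eq_or_lt with rfl | h
  · rfl
  · exact (op_lt_op_left h hy hz).le

theorem lt_op {x t : M} (ht : J.zero < t) (h : (x, t) ∈ J.dom) : x < J.op x t := by
  have hx := J.op_zero x (mem_of_dom h).1
  calc x = J.op x J.zero := hx.2.symm
    _ < _ := op_lt_op_left ht hx.1 h

theorem pos_of_neg {x z : M} (hx : x < J.zero) (h : (x, z) ∈ J.dom) (h0 : J.op x z = J.zero) :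
    J.zero < z := by
  have hz := zero_dom (mem_of_dom h).2
  have := J.op_lt_op _ _ _ hx h hz.1
  rwa [h0, hz.2] at this

theorem dom_of_lt_of_pos {x y z : M} (hx : J.zero < x) (hy : J.zero < y) (hyz : y < z)
    (h : (x, z) ∈ J.dom) : (x, y) ∈ J.dom := by
  obtain ⟨r, -, hr, -⟩ := J.exists_radius x (mem_of_dom h).1 hx
  exact (hr y hy).2 ((WithTop.coe_lt_coe.2 hyz).trans ((hr z (hy.trans hyz)).1 h))

variable [OrderTopology M] [DenselyOrdered M] [NoMinOrder M] [NoMaxOrder M]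

theorem exists_gt_mem {x : M} (hx : x ∈ J.carrier) : ∃ y ∈ J.carrier, x < y := by
  have : ∃ y, x < y ∧ (y : WithTop M) < J.hi := by
    have h := hx.2
    cases hhi : J.hi using WithTop.recTopCoe with
    | top =>
      obtain ⟨y, hy⟩ := exists_gt x
      exact ⟨y, hy, WithTop.coe_lt_top y⟩
    | coe b =>
      rw [hhi, WithTop.coe_lt_coe] at h
      obtain ⟨y, hy, hy'⟩ := exists_between h
      exact ⟨y, hy, WithTop.coe_lt_coe.2 hy'⟩
  obtain ⟨y, hy, hy'⟩ := this
  exact ⟨y, ⟨hx.1.trans (WithBot.coe_lt_coe.2 hy), hy'⟩, hy⟩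

theorem exists_lt_mem {x : M} (hx : x ∈ J.carrier) : ∃ y ∈ J.carrier, y < x := by
  have : ∃ y, y < x ∧ J.lo < (y : WithBot M) := by
    have h := hx.1
    cases hlo : J.lo using WithBot.recBotCoe with
    | bot =>
      obtain ⟨y, hy⟩ := exists_lt x
      exact ⟨y, hy, WithBot.bot_lt_coe y⟩
    | coe b =>
      rw [hlo, WithBot.coe_lt_coe] at h
      obtain ⟨y, hy, hy'⟩ := exists_between h
      exact ⟨y, hy', WithBot.coe_lt_coe.2 hy⟩
  obtain ⟨y, hy, hy'⟩ := this
  exact ⟨y, ⟨hy', (WithTop.coe_lt_coe.2 hy).trans hx.2⟩, hy⟩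

theorem isOpen_carrier : IsOpen J.carrier := by
  rw [isOpen_iff_mem_nhds]
  intro x hx
  obtain ⟨y, hy, hxy⟩ := exists_gt_mem hx
  obtain ⟨z, hz, hxz⟩ := exists_lt_mem hx
  exact mem_of_superset (Ioo_mem_nhds hxz hxy)
    (Ioo_subset_Icc_self.trans (ordConnected_carrier.out hz hy))

theorem eventually_op_lt {a s y : M} (h : (a, s) ∈ J.dom) (hy : J.op a s < y) :
    ∃ l r, l < s ∧ s < r ∧ ∀ t, l < t → t < r → (a, t) ∈ J.dom → J.op a t < y := by
  have h1 := (J.continuousOn_op (a, s) h).eventually_lt_const hy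
  rw [eventually_nhdsWithin_iff] at h1
  have h2 := (Continuous.tendsto (by fun_prop : Continuous fun t : M => (a, t)) s).eventually h1
  obtain ⟨l, r, hlr, hsub⟩ := mem_nhds_iff_exists_Ioo_subset.1 h2
  exact ⟨l, r, hlr.1, hlr.2, fun t h1 h2 => hsub ⟨h1, h2⟩⟩

theorem eventually_lt_op {a s y : M} (h : (a, s) ∈ J.dom) (hy : y < J.op a s) :
    ∃ l r, l < s ∧ s < r ∧ ∀ t, l < t → t < r → (a, t) ∈ J.dom → y < J.op a t := by
  have h1 := (J.continuousOn_op (a, s) h).eventually_const_lt hy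
  rw [eventually_nhdsWithin_iff] at h1
  have h2 := (Continuous.tendsto (by fun_prop : Continuous fun t : M => (a, t)) s).eventually h1
  obtain ⟨l, r, hlr, hsub⟩ := mem_nhds_iff_exists_Ioo_subset.1 h2
  exact ⟨l, r, hlr.1, hlr.2, fun t h1 h2 => hsub ⟨h1, h2⟩⟩

variable {L : FirstOrder.Language.{u, v}} [L.Structure M] [Tame L M]

theorem IsDefinable.dRel3 (hJ : J.IsDefinable L) : DRel3 L J.Add := .of ⟨hJ⟩

theorem isDefInterval (J : GroupInterval M) : IsDefInterval L J.carrier where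
  isDef := by
    have h1 : DSet L {x : M | J.lo < (x : WithBot M)} := by
      cases J.lo using WithBot.recBotCoe with
      | bot => simp only [WithBot.bot_lt_coe]; exact .of inferInstance
      | coe a => simp only [WithBot.coe_lt_coe]; exact .of inferInstance
    have h2 : DSet L {x : M | (x : WithTop M) < J.hi} := by
      cases J.hi using WithTop.recTopCoe with
      | top => simp only [WithTop.coe_lt_top]; exact .of inferInstance
      | coe a => simp only [WithTop.coe_lt_coe]; exact .of inferInstance
    exact .of (P := fun x => x ∈ {x : M | J.lo < (x : WithBot M)} ∧
      x ∈ {x : M | (x : WithTop M) < J.hi}) inferInstance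
  ordConnected := ordConnected_carrier
  exists_lt _ := exists_lt_mem
  exists_gt _ := exists_gt_mem

/-- Intermediate values of `t ↦ a + t`. -/
theorem exists_add_eq (hJ : J.IsDefinable L) {a t₀ y : M} (ht₀ : J.zero < t₀)
    (hdom : ∀ t, J.zero < t → t ≤ t₀ → (a, t) ∈ J.dom) (hay : a < y) (hy : y < J.op a t₀) :
    ∃ t, J.zero < t ∧ t < t₀ ∧ J.Add a t y := by
  have := hJ.dRel3
  have h0 := J.op_zero a (mem_of_dom (hdom t₀ ht₀ le_rfl)).1
  let A : Set M := {t | J.zero ≤ t ∧ t ≤ t₀ ∧ ∃ z, J.Add a t z ∧ z < y}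
  have hA0 : J.zero ∈ A := ⟨le_rfl, ht₀.le, a, h0, hay⟩
  obtain ⟨s, hs⟩ := exists_isLUB_of_definable L A (.of inferInstance) ⟨_, hA0⟩
    ⟨t₀, fun t ht => ht.2.1⟩
  have hs0 : J.zero ≤ s := hs.1 hA0
  have hst : s ≤ t₀ := hs.2 fun t ht => ht.2.1
  have hdom' : ∀ t, J.zero ≤ t → t ≤ t₀ → (a, t) ∈ J.dom := fun t h1 h2 => by
    rcases h1.eq_or_lt with rfl | h1
    · exact h0.1
    · exact hdom t h1 h2
  have hsd := hdom' s hs0 hst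
  rcases lt_trichotomy (J.op a s) y with h | h | h
  · exfalso
    have hst' : s < t₀ := hst.lt_of_ne fun h' => (h' ▸ h).not_gt hy
    obtain ⟨l, r, hl, hr, hlr⟩ := eventually_op_lt hsd h
    obtain ⟨t, ht1, ht2⟩ := exists_between (lt_min hr hst')
    rw [lt_min_iff] at ht2
    have hd := hdom' t (hs0.trans ht1.le) ht2.2.le
    have htA : t ∈ A := ⟨hs0.trans ht1.le, ht2.2.le, _, ⟨hd, rfl⟩, hlr t (hl.trans ht1) ht2.1 hd⟩
    exact (hs.1 htA).not_gt ht1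
  · refine ⟨s, hs0.lt_of_ne fun h' => ?_, hst.lt_of_ne fun h' => ?_, hsd, h⟩
    · rw [← h', h0.2] at h
      exact hay.ne h
    · rw [← h, h'] at hy
      exact hy.false
  · exfalso
    obtain ⟨l, r, hl, hr, hlr⟩ := eventually_lt_op hsd h
    obtain ⟨t, htA, ht⟩ : ∃ t ∈ A, l < t := by
      by_contra! h'
      exact (hs.2 h').not_gt hl
    obtain ⟨z, hz, hzy⟩ := htA.2.2
    exact (hlr t ht ((hs.1 htA).trans_lt hr) hz.1).not_gt (hz.2 ▸ hzy)

/-- Subtraction of positive elements. -/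
theorem exists_add_eq_of_pos_of_lt (hJ : J.IsDefinable L) {z x : M} (hz : J.zero < z) (hzx : z < x)
    (hx : x ∈ J.carrier) : ∃ w, J.zero < w ∧ J.Add z w x := by
  have hzC : z ∈ J.carrier := ordConnected_carrier.out zero_mem' hx ⟨hz.le, hzx.le⟩
  obtain ⟨r, -, hr, hlim⟩ := J.exists_radius z hzC hz
  obtain ⟨d, hd0, hdr, hd⟩ := hlim x hx.2
  obtain ⟨u, hdu, hur⟩ : ∃ u, d < u ∧ (u : WithTop M) < r := by
    cases r using WithTop.recTopCoe with
    | top =>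
      obtain ⟨y, hy⟩ := exists_gt d
      exact ⟨y, hy, WithTop.coe_lt_top y⟩
    | coe b =>
      obtain ⟨y, hy, hy'⟩ := exists_between (WithTop.coe_lt_coe.1 hdr)
      exact ⟨y, hy, WithTop.coe_lt_coe.2 hy'⟩
  obtain ⟨w, hw, -, h⟩ := exists_add_eq hJ (hd0.trans hdu)
    (fun t h1 h2 => (hr t h1).2 ((WithTop.coe_le_coe.2 h2).trans_lt hur)) hzx (hd u hdu hur)
  exact ⟨w, hw, h⟩

/-- The sum of a negative and a positive element is always defined. -/
theorem dom_of_neg_of_pos (hJ : J.IsDefinable L) {y s : M} (hyC : y ∈ J.carrier)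
    (hsC : s ∈ J.carrier) (hy : y < J.zero) (hs : J.zero < s) : (y, s) ∈ J.dom := by
  obtain ⟨z, hyz, hz⟩ := J.exists_neg y hyC
  have hz0 := pos_of_neg hy hyz hz
  rcases lt_trichotomy s z with h | rfl | h
  · -- write `z = s + w`; then `s = z + (-w)`
    obtain ⟨w, hw0, hw, hw'⟩ := exists_add_eq_of_pos_of_lt hJ hs h (mem_of_dom hyz).2
    obtain ⟨n, hn, hn'⟩ := J.exists_neg w (mem_of_dom hw).2
    have h1 := J.op_assoc s w n hw hn
    rw [hw', hn'] at h1
    have h2 : (z, n) ∈ J.dom := h1.1.2 (J.op_zero s hsC).1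
    have h3 : J.op z n = s := (h1.2 h2).trans (J.op_zero s hsC).2
    have h4 := J.op_assoc y z n hyz h2
    rw [hz, h3] at h4
    exact h4.1.1 (zero_dom (mem_of_dom hn).2).1
  · exact hyz
  · obtain ⟨w, hw0, hw, hw'⟩ := exists_add_eq_of_pos_of_lt hJ hz0 h hsC
    have h1 := J.op_assoc y z w hyz hw
    rw [hz, hw'] at h1
    exact h1.1.1 (zero_dom (mem_of_dom hw).2).1

theorem dom_of_lt_right (hJ : J.IsDefinable L) {x s t : M} (h : (x, s) ∈ J.dom) (ht : J.zero < t)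
    (hts : t ≤ s) : (x, t) ∈ J.dom := by
  rcases hts.eq_or_lt with rfl | hts
  · exact h
  have htC : t ∈ J.carrier := ordConnected_carrier.out zero_mem' (mem_of_dom h).2 ⟨ht.le, hts.le⟩
  rcases lt_trichotomy x J.zero with hx | rfl | hx
  · exact dom_of_neg_of_pos hJ (mem_of_dom h).1 htC hx ht
  · exact (zero_dom htC).1
  · exact dom_of_lt_of_pos hx ht hts h

theorem dom_of_lt_left (hJ : J.IsDefinable L) {x x' s : M} (h : (x', s) ∈ J.dom) (hs : J.zero < s)
    (hxC : x ∈ J.carrier) (hxx' : x ≤ x') : (x, s) ∈ J.dom := by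
  rcases hxx'.eq_or_lt with rfl | hxx'
  · exact h
  rcases lt_trichotomy x J.zero with hx | rfl | hx
  · exact dom_of_neg_of_pos hJ hxC (mem_of_dom h).2 hx hs
  · exact (zero_dom (mem_of_dom h).2).1
  · exact dom_swap (dom_of_lt_of_pos hs hx hxx' (dom_swap h))

theorem exists_pos_dom (hJ : J.IsDefinable L) {x : M} (hx : x ∈ J.carrier) :
    ∃ e, J.zero < e ∧ (x, e) ∈ J.dom := by
  obtain ⟨s, hs, hs0⟩ := exists_gt_mem (J := J) zero_mem'
  rcases lt_trichotomy x J.zero with hx0 | rfl | hx0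
  · exact ⟨s, hs0, dom_of_neg_of_pos hJ hx hs hx0 hs0⟩
  · exact ⟨s, hs0, (zero_dom hs).1⟩
  · obtain ⟨y, hy, hxy⟩ := exists_gt_mem hx
    obtain ⟨w, hw, h⟩ := exists_add_eq_of_pos_of_lt hJ hx0 hxy hy
    exact ⟨w, hw, h.1⟩

/-- `x + e` is defined and below a given bound `y > x` for some positive `e`, which can be taken
below any given positive element. -/
theorem exists_pos_op_lt (hJ : J.IsDefinable L) {x y d : M} (hx : x ∈ J.carrier) (hxy : x < y)
    (hd : J.zero < d) : ∃ e, J.zero < e ∧ e < d ∧ (x, e) ∈ J.dom ∧ J.op x e < y := by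
  obtain ⟨e, he, hxe⟩ := exists_pos_dom hJ hx
  have h0 := J.op_zero x hx
  obtain ⟨l, r, hl, hr, hlr⟩ := eventually_op_lt h0.1 (by rwa [h0.2] : J.op x J.zero < y)
  obtain ⟨t, ht1, ht2⟩ := exists_between (lt_min hr (lt_min he hd))
  simp only [lt_min_iff] at ht2
  have hd := dom_of_lt_right hJ hxe ht1 ht2.2.1.le
  exact ⟨t, ht1, ht2.2.2, hd, hlr t (hl.trans ht1) ht2.1 hd⟩

/-- Points just to the right of `a` are of the form `a + t` with `t` small. -/
theorem exists_add_eq_right (hJ : J.IsDefinable L) {a e : M} (ha : a ∈ J.carrier)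
    (he : J.zero < e) :
    ∃ y₀, a < y₀ ∧ ∀ y, a < y → y < y₀ → ∃ t, J.zero < t ∧ t < e ∧ J.Add a t y := by
  obtain ⟨b, hb⟩ := exists_gt a
  obtain ⟨t₀, h1, h2, h3, -⟩ := exists_pos_op_lt hJ ha hb he
  refine ⟨J.op a t₀, lt_op h1 h3, fun y hy hy' => ?_⟩
  obtain ⟨t, ht, ht', h⟩ := exists_add_eq hJ h1
    (fun t ht ht' => dom_of_lt_right hJ h3 ht ht') hy hy'
  exact ⟨t, ht, ht'.trans h2, h⟩

/-- For points `s` just to the left of `a` there are small `t` with `s + t = a`. -/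
theorem exists_add_eq_left (hJ : J.IsDefinable L) {a e : M} (ha : a ∈ J.carrier)
    (he : J.zero < e) :
    ∃ s₀, s₀ < a ∧ ∀ s, s₀ < s → s < a → ∃ t, J.zero < t ∧ t < e ∧ J.Add s t a := by
  obtain ⟨b, hb⟩ := exists_gt a
  obtain ⟨t₀, h1, h2, h3, -⟩ := exists_pos_op_lt hJ ha hb he
  obtain ⟨l, r, hl, hr, hlr⟩ := eventually_lt_op (dom_swap h3)
    ((J.op_comm _ _ h3).2 ▸ lt_op h1 h3)
  obtain ⟨c, hc, hca⟩ := exists_lt_mem ha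
  refine ⟨max l c, max_lt hl hca, fun s hs hsa => ?_⟩
  rw [max_lt_iff] at hs
  have hsC : s ∈ J.carrier := ordConnected_carrier.out hc ha ⟨hs.2.le, hsa.le⟩
  have hd := dom_of_lt_left hJ h3 h1 hsC hsa.le
  obtain ⟨t, ht, ht', h⟩ := exists_add_eq hJ h1
    (fun t ht ht' => dom_of_lt_right hJ hd ht ht') hsa
    ((J.op_comm _ _ hd).2 ▸ hlr s hs.1 (hsa.trans hr) (dom_swap hd))
  exact ⟨t, ht, ht'.trans h2, h⟩

theorem Add.lt_iff {a t₁ t₂ y₁ y₂ : M} (h₁ : J.Add a t₁ y₁) (h₂ : J.Add a t₂ y₂) :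
    t₁ < t₂ ↔ y₁ < y₂ := by
  rw [← h₁.2, ← h₂.2]
  exact ⟨fun h => op_lt_op_left h h₁.1 h₂.1,
    fun h => lt_of_not_ge fun h' => (op_le_op_left h' h₂.1 h₁.1).not_gt h⟩

theorem Add.lt_iff_gt (hJ : J.IsDefinable L) {a t₁ t₂ s₁ s₂ : M} (h₁ : J.Add s₁ t₁ a)
    (h₂ : J.Add s₂ t₂ a) (ht₁ : J.zero < t₁) (ht₂ : J.zero < t₂) : t₁ < t₂ ↔ s₂ < s₁ := by
  have key : ∀ {t₁ t₂ s₁ s₂}, J.Add s₁ t₁ a → J.Add s₂ t₂ a → J.zero < t₁ → t₁ < t₂ → s₂ < s₁ := by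
    intro t₁ t₂ s₁ s₂ h₁ h₂ ht₁ h
    by_contra! hle
    have hd := dom_of_lt_left hJ h₂.1 (ht₁.trans h) (mem_of_dom h₁.1).1 hle
    have h3 : a < J.op s₁ t₂ := h₁.2 ▸ op_lt_op_left h h₁.1 hd
    have h4 : J.op s₁ t₂ ≤ a := by
      rw [← h₂.2, (J.op_comm _ _ hd).2, (J.op_comm _ _ h₂.1).2]
      exact op_le_op_left hle (dom_swap hd) (dom_swap h₂.1)
    exact (h3.trans_le h4).false
  refine ⟨key h₁ h₂ ht₁, fun h => ?_⟩
  rcases lt_trichotomy t₁ t₂ with h' | rfl | h'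
  · exact h'
  · have := J.op_lt_op _ _ _ h h₂.1 h₁.1
    rw [h₁.2, h₂.2] at this
    exact absurd this (lt_irrefl _)
  · exact absurd (key h₂ h₁ ht₂ h') h.not_gt

end Arithmetic

section GermOfFunction

variable {M : Type w} [LinearOrder M] [TopologicalSpace M] [OrderTopology M] [DenselyOrdered M]
  [NoMinOrder M] [NoMaxOrder M] {L : FirstOrder.Language.{u, v}} [L.Structure M] [Tame L M]

/-- If the germs at the zeros of two group-intervals are not comparable, then every definable
function between them has infinite fibres: otherwise it would be a monotone bijection between two
intervals, which translations would carry to the germs at the zeros. -/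
theorem hasInfiniteFibers_of_not_germEquiv {I J : GroupInterval M} (hI : I.IsDefinable L)
    (hJ : J.IsDefinable L) (h : ¬ GermEquiv L I.zero J.zero) :
    HasInfiniteFibers L I.carrier J.carrier := by
  intro E f hE hf hEI hinf hfJ
  by_contra! hfin
  have := hI.dRel3
  have := hJ.dRel3
  obtain ⟨p, q, u, v, hpq, huv, hsub, himg, hmon⟩ := exists_monotone_bijection L hinf
    (f := f) hfin
  obtain ⟨a', hua, hav⟩ := exists_between huv
  obtain ⟨a, ha, rfl⟩ : a' ∈ f '' Ioo p q := himg ▸ ⟨hua, hav⟩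
  have haI := hEI (hsub ha)
  have haJ := hfJ (hsub ha)
  apply h
  rcases hmon with hmon | hmon
  · refine ⟨fun t t' => I.zero < t ∧ J.zero < t' ∧ ∃ y, (p < y ∧ y < q) ∧ I.Add a t y ∧
      J.Add (f a) t' (f y), .of inferInstance, fun s s' h => ⟨h.1, h.2.1⟩, ?_, ?_⟩
    · rintro s s' t t' ⟨-, -, y, hy, hs, hs'⟩ ⟨-, -, z, hz, ht, ht'⟩
      rw [hs.lt_iff ht, hs'.lt_iff ht', hmon.lt_iff_lt hy hz]
    · intro e e' he he'
      obtain ⟨y₀, hy₀, h1⟩ := exists_add_eq_right hI haI he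
      obtain ⟨z₀, hz₀, h2⟩ := exists_add_eq_right hJ haJ he'
      obtain ⟨w, hw1, hw2⟩ := exists_between (lt_min hz₀ hav)
      rw [lt_min_iff] at hw2
      obtain ⟨w, hw, rfl⟩ : w ∈ f '' Ioo p q := himg ▸ ⟨hua.trans hw1, hw2.2⟩
      have haw := (hmon.lt_iff_lt ha hw).1 hw1
      obtain ⟨y, hay, hy⟩ := exists_between (lt_min hy₀ haw)
      rw [lt_min_iff] at hy
      have hyI : y ∈ Ioo p q := ⟨ha.1.trans hay, hy.2.trans hw.2⟩
      obtain ⟨t, ht0, ht, hadd⟩ := h1 y hay hy.1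
      obtain ⟨t', ht0', ht', hadd'⟩ := h2 (f y) (hmon ha hyI hay) ((hmon hyI hw hy.2).trans hw2.1)
      exact ⟨t, t', ⟨ht0, ht0', y, hyI, hadd, hadd'⟩, ht, ht'⟩
  · refine ⟨fun t t' => I.zero < t ∧ J.zero < t' ∧ ∃ y, (p < y ∧ y < q) ∧ I.Add y t a ∧
      J.Add (f a) t' (f y), .of inferInstance, fun s s' h => ⟨h.1, h.2.1⟩, ?_, ?_⟩
    · rintro s s' t t' ⟨hs0, -, y, hy, hs, hs'⟩ ⟨ht0, -, z, hz, ht, ht'⟩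
      rw [hs.lt_iff_gt hI ht hs0 ht0, hs'.lt_iff ht', hmon.lt_iff_gt hy hz]
    · intro e e' he he'
      obtain ⟨y₀, hy₀, h1⟩ := exists_add_eq_left hI haI he
      obtain ⟨z₀, hz₀, h2⟩ := exists_add_eq_right hJ haJ he'
      obtain ⟨w, hw1, hw2⟩ := exists_between (lt_min hz₀ hav)
      rw [lt_min_iff] at hw2
      obtain ⟨w, hw, rfl⟩ : w ∈ f '' Ioo p q := himg ▸ ⟨hua.trans hw1, hw2.2⟩
      have haw := (hmon.lt_iff_gt ha hw).1 hw1
      obtain ⟨y, hy, hay⟩ := exists_between (max_lt hy₀ haw)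
      rw [max_lt_iff] at hy
      have hyI : y ∈ Ioo p q := ⟨hw.1.trans hy.2, hay.trans ha.2⟩
      obtain ⟨t, ht0, ht, hadd⟩ := h1 y hy.1 hay
      obtain ⟨t', ht0', ht', hadd'⟩ := h2 (f y) (hmon hyI ha hay) ((hmon hw hyI hy.2).trans hw2.1)
      exact ⟨t, t', ⟨ht0, ht0', y, hyI, hadd, hadd'⟩, ht, ht'⟩

end GermOfFunction

end GroupInterval

/-! ### Interiors and closures of definable sets -/

section Interior

variable {L : FirstOrder.Language.{u, v}} {M : Type w} [L.Structure M] [LinearOrder M]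
  [DenselyOrdered M] [NoMinOrder M] [NoMaxOrder M] [TopologicalSpace M] [OrderTopology M]
  {α : Type} [Finite α]

theorem mem_nhds_pi_iff_box {S : Set (α → M)} {p : α → M} :
    S ∈ 𝓝 p ↔ ∃ l u : α → M, (∀ a, l a < p a ∧ p a < u a) ∧
      ∀ q, (∀ a, l a < q a ∧ q a < u a) → q ∈ S := by
  constructor
  · intro h
    rw [nhds_pi, Filter.mem_pi'] at h
    obtain ⟨I, t, ht, hsub⟩ := h
    choose l u hlu h using fun a => mem_nhds_iff_exists_Ioo_subset.1 (ht a)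
    exact ⟨l, u, hlu, fun q hq => hsub fun a _ => h a (hq a)⟩
  · rintro ⟨l, u, hlu, h⟩
    have : univ.pi (fun a => Ioo (l a) (u a)) ∈ 𝓝 p :=
      set_pi_mem_nhds finite_univ fun a _ => Ioo_mem_nhds (hlu a).1 (hlu a).2
    exact mem_of_superset this fun q hq => h q fun a => hq a (mem_univ a)

variable [Tame L M]

theorem IsDef.interior {S : Set (α → M)} (hS : IsDef L S) : IsDef L (interior S) := by
  have : DTup L S := ⟨hS⟩
  have h : DPred L (fun p : α → M => ∃ l u : α → M, (∀ a, l a < p a ∧ p a < u a) ∧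
      ∀ q : α → M, (∀ a, l a < q a ∧ q a < u a) → q ∈ S) := inferInstance
  convert! h.isDef using 1
  ext p
  rw [mem_interior_iff_mem_nhds, mem_nhds_pi_iff_box]
  rfl

theorem IsDef.closure {S : Set (α → M)} (hS : IsDef L S) : IsDef L (closure S) := by
  have h : IsDef L (_root_.interior Sᶜ) := IsDef.interior (Set.Definable.compl hS)
  rw [interior_compl] at h
  simpa [IsDef] using Set.Definable.compl h

end Interior

/-! ### Scales: definable uniformities with one parameter -/

section Scale

/-- A definable uniformity on `C`, whose basic entourages `B t` are parametrised by the points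
`t > z` and shrink to the diagonal as `t` approaches `z`.  It plays the role of a metric with
values in the right germ of `M` at `z`. -/
structure IsScale (L : FirstOrder.Language.{u, v}) {M : Type w} [L.Structure M] [LinearOrder M]
    [TopologicalSpace M] (C : Set M) (z : M) (B : M → M → M → Prop) : Prop where
  isDef : DRel3 L B
  mono : ∀ s t x y, z < s → s ≤ t → B s x y → B t x y
  symm : ∀ t x y, B t x y → B t y x
  nhds : ∀ x ∈ C, ∀ t, z < t → ∀ᶠ y in 𝓝 x, B t x y
  basis : ∀ x ∈ C, ∀ W ∈ 𝓝 x, ∃ t, z < t ∧ ∀ y ∈ C, B t x y → y ∈ W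
  triangle : ∀ t, z < t → ∃ s, z < s ∧ ∀ x ∈ C, ∀ y ∈ C, ∀ w ∈ C, B s x y → B s y w → B t x w

variable {L : FirstOrder.Language.{u, v}} {M : Type w} [L.Structure M] [LinearOrder M]
  [DenselyOrdered M] [NoMinOrder M] [NoMaxOrder M] [TopologicalSpace M] [OrderTopology M]
  [Tame L M]

/-- The entourages of a group-interval: `y < x + t` and `x < y + t`, where an undefined sum counts
as larger than every element. -/
def GroupInterval.near (J : GroupInterval M) (t x y : M) : Prop :=
  (∀ w, J.Add x t w → y < w) ∧ ∀ w, J.Add y t w → x < w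

open GroupInterval in
theorem GroupInterval.isScale {J : GroupInterval M} (hJ : J.IsDefinable L) :
    IsScale L J.carrier J.zero J.near := by
  have := hJ.dRel3
  have hmono : ∀ s t x y, J.zero < s → s ≤ t → J.near s x y → J.near t x y := by
    have key : ∀ s t x y, J.zero < s → s ≤ t → (∀ w, J.Add x s w → y < w) →
        ∀ w, J.Add x t w → y < w := by
      rintro s t x y hs hst h _ ⟨hw, rfl⟩
      have hd := dom_of_lt_right hJ hw hs hst
      exact (h _ ⟨hd, rfl⟩).trans_le (op_le_op_left hst hd hw)
    exact fun s t x y hs hst h => ⟨key s t x y hs hst h.1, key s t y x hs hst h.2⟩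
  refine ⟨?_, hmono, fun t x y h => ⟨h.2, h.1⟩, ?_, ?_, ?_⟩
  · unfold near
    exact .of inferInstance
  · intro x hx t ht
    obtain ⟨b, hb⟩ := exists_gt x
    obtain ⟨e, he0, het, hd, -⟩ := exists_pos_op_lt hJ hx hb ht
    have hlt := lt_op he0 hd
    obtain ⟨l, r, hl, hr, hlr⟩ := eventually_lt_op (dom_swap hd) ((J.op_comm _ _ hd).2 ▸ hlt)
    filter_upwards [Iio_mem_nhds hlt, Ioo_mem_nhds hl hr] with y hy hy'
    refine hmono e t x y he0 het.le ⟨?_, ?_⟩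
    · rintro _ ⟨-, rfl⟩
      exact hy
    · rintro _ ⟨hd', rfl⟩
      rw [(J.op_comm _ _ hd').2]
      exact hlr y hy'.1 hy'.2 (dom_swap hd')
  · intro x hx W hW
    obtain ⟨a, b, hab, hsub⟩ := mem_nhds_iff_exists_Ioo_subset.1 hW
    obtain ⟨c, hc, hcx⟩ := exists_lt_mem hx
    have hmC : max a c ∈ J.carrier :=
      ordConnected_carrier.out hc hx ⟨le_max_right _ _, (max_lt hab.1 hcx).le⟩
    obtain ⟨s, hs⟩ := exists_gt J.zero
    obtain ⟨e₁, he₁, -, hd₁, hb₁⟩ := exists_pos_op_lt hJ hx hab.2 hs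
    obtain ⟨e₂, he₂, he₂₁, hd₂, hb₂⟩ := exists_pos_op_lt hJ hmC (max_lt hab.1 hcx) he₁
    refine ⟨e₂, he₂, fun y hy hB => hsub ⟨?_, ?_⟩⟩
    · by_contra! hle
      have hle' : y ≤ max a c := hle.trans (le_max_left _ _)
      have hd := dom_of_lt_left hJ hd₂ he₂ hy hle'
      have h1 : J.op y e₂ ≤ J.op (max a c) e₂ := by
        rw [(J.op_comm _ _ hd).2, (J.op_comm _ _ hd₂).2]
        exact op_le_op_left hle' (dom_swap hd) (dom_swap hd₂)
      exact ((hB.2 _ ⟨hd, rfl⟩).trans_le h1).not_gt hb₂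
    · have hd := dom_of_lt_right hJ hd₁ he₂ he₂₁.le
      exact ((hB.1 _ ⟨hd, rfl⟩).trans (op_lt_op_left he₂₁ hd hd₁)).trans hb₁
  · intro t ht
    by_cases htC : t ∈ J.carrier
    · -- take `s` with `s + s ≤ t`
      obtain ⟨s, hs0, hss, hst⟩ : ∃ s, J.zero < s ∧ (s, s) ∈ J.dom ∧ J.op s s ≤ t := by
        obtain ⟨u, hu0, hut⟩ := exists_between ht
        obtain ⟨w, hw0, hw, rfl⟩ := exists_add_eq_of_pos_of_lt hJ hu0 hut htC
        have h1 := dom_of_lt_right hJ hw (lt_min hu0 hw0) (min_le_right u w)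
        have h2 := dom_of_lt_left hJ h1 (lt_min hu0 hw0) (x := min u w)
          (ordConnected_carrier.out zero_mem' (mem_of_dom hw).1
            ⟨(lt_min hu0 hw0).le, min_le_left _ _⟩) (min_le_left _ _)
        refine ⟨min u w, lt_min hu0 hw0, h2, ?_⟩
        calc J.op (min u w) (min u w) ≤ J.op u (min u w) := by
              rw [(J.op_comm _ _ h1).2]
              exact op_le_op_left (min_le_left _ _) h2 (dom_swap h1)
          _ ≤ J.op u w := op_le_op_left (min_le_right _ _) h1 hw
      have key : ∀ x y w, y ∈ J.carrier → J.near s x y → J.near s y w →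
          ∀ v, J.Add x t v → w < v := by
        rintro x y w hy hxy hyw _ ⟨hv, rfl⟩
        have hs2 : J.zero < J.op s s := hs0.trans (lt_op hs0 hss)
        have h1 := dom_of_lt_right hJ hv hs2 hst
        have h2 := dom_of_lt_right hJ h1 hs0 (lt_op hs0 hss).le
        have h3 := J.op_assoc x s s h2 hss
        have h4 := h3.1.2 h1
        have hyx := hxy.1 _ ⟨h2, rfl⟩
        have h5 := dom_of_lt_left hJ h4 hs0 hy hyx.le
        calc w < J.op y s := hyw.1 _ ⟨h5, rfl⟩
          _ < J.op (J.op x s) s := J.op_lt_op _ _ _ hyx h5 h4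
          _ = J.op x (J.op s s) := h3.2 h4
          _ ≤ J.op x t := op_le_op_left hst h1 hv
      exact ⟨s, hs0, fun x _ y hy w _ hxy hyw =>
        ⟨key x y w hy hxy hyw, key w y x hy ⟨hyw.2, hyw.1⟩ ⟨hxy.2, hxy.1⟩⟩⟩
    · exact ⟨t, ht, fun x _ y _ w _ _ _ => ⟨fun v hv => absurd (mem_of_dom hv.1).2 htC,
        fun v hv => absurd (mem_of_dom hv.1).2 htC⟩⟩

/-- Scales are transported along comparable germs. -/
theorem GermEquiv.exists_isScale {C : Set M} {z z' : M} (h : GermEquiv L z z')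
    {B : M → M → M → Prop} (hB : IsScale L C z' B) : ∃ B', IsScale L C z B' := by
  obtain ⟨Θ, hΘ, h1, h2, h3⟩ := h
  have := hB.isDef
  obtain ⟨b, hb⟩ := exists_gt z
  obtain ⟨b', hb'⟩ := exists_gt z'
  have hle : ∀ s s' t t', Θ s s' → Θ t t' → s ≤ t → s' ≤ t' := fun s s' t t' hs ht hst =>
    not_lt.1 fun h => hst.not_gt ((h2 _ _ _ _ ht hs).2 h)
  refine ⟨fun t x y => ∀ s s', Θ s s' → t ≤ s → B s' x y, .of inferInstance, ?_, ?_, ?_, ?_, ?_⟩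
  · exact fun s t x y _ hst h r r' hr htr => h r r' hr (hst.trans htr)
  · exact fun t x y h s s' hs hst => hB.symm _ _ _ (h s s' hs hst)
  · intro x hx t ht
    obtain ⟨s₀, s₀', hs₀, hlt, -⟩ := h3 t b' ht hb'
    filter_upwards [hB.nhds x hx s₀' (h1 _ _ hs₀).2] with y hy s s' hs hts
    exact hB.mono _ _ _ _ (h1 _ _ hs₀).2 (hle _ _ _ _ hs₀ hs (hlt.le.trans hts)) hy
  · intro x hx W hW
    obtain ⟨t', ht', hW'⟩ := hB.basis x hx W hW
    obtain ⟨s, s', hs, -, hlt⟩ := h3 b t' hb ht'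
    exact ⟨s, (h1 _ _ hs).1, fun y hy hxy =>
      hW' y hy (hB.mono _ _ _ _ (h1 _ _ hs).2 hlt.le (hxy s s' hs le_rfl))⟩
  · intro t ht
    obtain ⟨s₀, s₀', hs₀, hlt, -⟩ := h3 t b' ht hb'
    obtain ⟨r', hr', htri⟩ := hB.triangle s₀' (h1 _ _ hs₀).2
    obtain ⟨s₁, s₁', hs₁, -, hlt₁⟩ := h3 b r' hb hr'
    refine ⟨s₁, (h1 _ _ hs₁).1, fun x hx y hy w hw hxy hyw s s' hs hts => ?_⟩
    refine hB.mono _ _ _ _ (h1 _ _ hs₀).2 (hle _ _ _ _ hs₀ hs (hlt.le.trans hts)) ?_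
    exact htri x hx y hy w hw (hB.mono _ _ _ _ (h1 _ _ hs₁).2 hlt₁.le (hxy s₁ s₁' hs₁ le_rfl))
      (hB.mono _ _ _ _ (h1 _ _ hs₁).2 hlt₁.le (hyw s₁ s₁' hs₁ le_rfl))

theorem exists_gt_forall_le {α : Type*} [Finite α] {z : M} {t : α → M} (ht : ∀ a, z < t a) :
    ∃ s, z < s ∧ ∀ a, s ≤ t a := by
  have h : ∀ᶠ s in 𝓝[>] z, ∀ a, s ≤ t a := eventually_all.2 fun a =>
    mem_nhdsWithin_of_mem_nhds (Iic_mem_nhds (ht a))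
  obtain ⟨s, hs, hzs⟩ := (h.and self_mem_nhdsWithin).exists
  exact ⟨s, hzs, hs⟩

/-- Two sets are separated by disjoint open definable sets. -/
def DefSep (L : FirstOrder.Language.{u, v}) {M : Type w} [L.Structure M] [TopologicalSpace M]
    {α : Type} (A B : Set (α → M)) : Prop :=
  ∃ O₁ O₂ : Set (α → M), IsDef L O₁ ∧ IsDef L O₂ ∧ IsOpen O₁ ∧ IsOpen O₂ ∧ Disjoint O₁ O₂ ∧
    A ⊆ O₁ ∧ B ⊆ O₂

/-- Definable separation in a box all of whose sides have a scale with values in the same germ.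
As in a metric space, a point of the first set gets the entourage-neighbourhood whose double still
misses the second set, and conversely; since scales are linearly ordered, these do not meet. -/
theorem defSep_of_isScale {α : Type} [Finite α] {C : α → Set M} {z : M}
    {B : α → M → M → M → Prop} (hC : ∀ a, DSet L (C a)) (hCo : ∀ a, IsOpen (C a))
    (hB : ∀ a, IsScale L (C a) z (B a)) {V Z₁ Z₂ : Set (α → M)}
    (hV : ∀ x ∈ V, ∀ a, x a ∈ C a) (hZ₁V : Z₁ ⊆ V) (hZ₂V : Z₂ ⊆ V) (hZ₁ : IsDef L Z₁)
    (hZ₂ : IsDef L Z₂) (hZ₁c : V ∩ closure Z₁ ⊆ Z₁) (hZ₂c : V ∩ closure Z₂ ⊆ Z₂)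
    (hdisj : Disjoint Z₁ Z₂) : DefSep L Z₁ Z₂ := by
  have hBd := fun a => (hB a).isDef
  let X : Set (α → M) := {x | ∀ a, x a ∈ C a}
  have hXd : DTup L X := ⟨(inferInstance : DPred L fun x : α → M => ∀ a, x a ∈ C a).isDef⟩
  let D : M → (α → M) → (α → M) → Prop := fun t x y => ∀ a, B a t (x a) (y a)
  let Tri : M → M → Prop := fun t t' => ∀ x y w : α → M, x ∈ X → y ∈ X → w ∈ X →
    (∀ a, B a t (x a) (y a)) → (∀ a, B a t (y a) (w a)) → ∀ a, B a t' (x a) (w a)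
  have hTri : DRel2 L Tri := .of inferInstance
  let N : Set (α → M) → Set (α → M) → Set (α → M) := fun Z Z' =>
    {y | y ∈ X ∧ ∃ x : α → M, x ∈ Z ∧ ∃ t t' : M, z < t ∧ Tri t t' ∧
      (∀ w : α → M, w ∈ Z' → ¬ ∀ a, B a t' (x a) (w a)) ∧ ∀ a, B a t (x a) (y a)}
  have hNdef : ∀ Z Z', IsDef L Z → IsDef L Z' → IsDef L (N Z Z') := by
    intro Z Z' hZ hZ'
    have : DTup L Z := ⟨hZ⟩
    have : DTup L Z' := ⟨hZ'⟩
    exact (inferInstance : DPred L _).isDef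
  have hNint : ∀ Z Z', Z ⊆ V → Z' ⊆ V → V ∩ closure Z' ⊆ Z' → Disjoint Z Z' →
      Z ⊆ interior (N Z Z') := by
    intro Z Z' hZ hZV' hZ' hd x hx
    have hxX : x ∈ X := hV x (hZ hx)
    have hxc : x ∉ closure Z' := fun h => disjoint_left.1 hd hx (hZ' ⟨hZ hx, h⟩)
    obtain ⟨l, u, hlu, hsub⟩ := mem_nhds_pi_iff_box.1 (isClosed_closure.compl_mem_nhds hxc)
    choose t₀ ht₀ hbas using fun a =>
      (hB a).basis (x a) (hxX a) _ (Ioo_mem_nhds (hlu a).1 (hlu a).2)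
    obtain ⟨t', ht', hle⟩ := exists_gt_forall_le ht₀
    choose s hs htri using fun a => (hB a).triangle t' ht'
    obtain ⟨t, ht, hle'⟩ := exists_gt_forall_le hs
    rw [mem_interior_iff_mem_nhds]
    have h1 : ∀ᶠ y in 𝓝 x, y ∈ X := eventually_all.2 fun a =>
      (continuous_apply a).tendsto x |>.eventually ((hCo a).mem_nhds (hxX a))
    have h2 : ∀ᶠ y in 𝓝 x, ∀ a, B a t (x a) (y a) := eventually_all.2 fun a =>
      (continuous_apply a).tendsto x |>.eventually ((hB a).nhds (x a) (hxX a) t ht)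
    filter_upwards [h1, h2] with y hyX hy
    refine ⟨hyX, x, hx, t, t', ht, ?_, ?_, hy⟩
    · intro x' y' w' hx' hy' hw' h3 h4 a
      exact htri a _ (hx' a) _ (hy' a) _ (hw' a) ((hB a).mono _ _ _ _ ht (hle' a) (h3 a))
        ((hB a).mono _ _ _ _ ht (hle' a) (h4 a))
    · intro w hw hxw
      exact hsub w (fun a => hbas a (w a) (hV w (hZV' hw) a)
        ((hB a).mono _ _ _ _ ht' (hle a) (hxw a))) (subset_closure hw)
  refine ⟨interior (N Z₁ Z₂), interior (N Z₂ Z₁), (hNdef _ _ hZ₁ hZ₂).interior,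
    (hNdef _ _ hZ₂ hZ₁).interior, isOpen_interior, isOpen_interior, ?_,
    hNint _ _ hZ₁V hZ₂V hZ₂c hdisj, hNint _ _ hZ₂V hZ₁V hZ₁c hdisj.symm⟩
  refine Disjoint.mono interior_subset interior_subset (disjoint_left.2 ?_)
  rintro y ⟨hyX, x, hx, t, t', ht, htri, hno, hxy⟩ ⟨-, w, hw, s, s', hs, htri', hno', hwy⟩
  have hxX := hV x (hZ₁V hx)
  have hwX := hV w (hZ₂V hw)
  rcases le_total t s with hts | hts
  · exact hno' x hx (htri' w y x hwX hyX hxX hwy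
      fun a => (hB a).symm _ _ _ ((hB a).mono _ _ _ _ ht hts (hxy a)))
  · exact hno w hw (htri x y w hxX hyX hwX hxy
      fun a => (hB a).symm _ _ _ ((hB a).mono _ _ _ _ hs hts (hwy a)))

end Scale

/-! ### Products of pairwise orthogonal factors -/

section Factors

variable {L : FirstOrder.Language.{u, v}} {M : Type w} [L.Structure M] {ι κ : Type}
  {cls : ι → κ}

/-- The coordinates of a tuple in the class `c`. -/
def coords (cls : ι → κ) (c : κ) (p : ι → M) : {i // cls i = c} → M := fun i => p i

open Classical in
/-- The tuple with coordinates `x` in the class `c` and `y` in the other classes. -/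
noncomputable def glue {c : κ} (x : {i // cls i = c} → M) (y : {i // cls i ≠ c} → M) : ι → M :=
  fun i => if h : cls i = c then x ⟨i, h⟩ else y ⟨i, h⟩

/-- The tuple whose coordinates in each class `c` are given by `x c`. -/
def assemble (x : ∀ c : κ, {i // cls i = c} → M) : ι → M := fun i => x (cls i) ⟨i, rfl⟩

theorem coords_assemble (x : ∀ c : κ, {i // cls i = c} → M) (c : κ) :
    coords cls c (assemble x) = x c := by
  funext ⟨i, hi⟩
  subst hi
  rfl

instance DFun.glue {α : Type} {c : κ} {x : (α → M) → {i // cls i = c} → M}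
    {y : (α → M) → {i // cls i ≠ c} → M} [hx : ∀ a, DFun L (fun v => x v a)]
    [hy : ∀ b, DFun L (fun v => y v b)] (i : ι) : DFun L (fun v => glue (x v) (y v) i) := by
  by_cases h : cls i = c
  · simpa only [_root_.glue, h, dite_true] using hx ⟨i, h⟩
  · simpa only [_root_.glue, h, dite_false] using hy ⟨i, h⟩

/-- The fibre of `S` over a tuple `x` of coordinates in the class `c`. -/
def fiberOver (C : ι → Set M) (S : Set (ι → M)) (c : κ) (x : {i // cls i = c} → M) :
    Set ({i // cls i ≠ c} → M) :=
  {y | (∀ b : {i // cls i ≠ c}, y b ∈ C b) ∧ glue x y ∈ S}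

/-- Two points of a box all of whose coordinate parts have the same fibres in `S` are both in `S` or
both outside. -/
theorem mem_of_fiberOver_eq [Finite κ] {C : ι → Set M} {S : Set (ι → M)} {p q : ι → M}
    (hp : ∀ i, p i ∈ C i) (hq : ∀ i, q i ∈ C i)
    (h : ∀ c, fiberOver C S c (coords cls c p) = fiberOver C S c (coords cls c q)) (hpS : p ∈ S) :
    q ∈ S := by
  classical
  cases nonempty_fintype κ
  -- change the coordinates of `p` into those of `q` one class at a time
  have key : ∀ T : Finset κ, (fun i => if cls i ∈ T then q i else p i) ∈ S := by
    intro T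
    induction T using Finset.induction_on with
    | empty => simpa using hpS
    | insert c T hc ih =>
      let y : {i // cls i ≠ c} → M := fun i => if cls i ∈ T then q i else p i
      have h1 : glue (coords cls c p) y = fun i => if cls i ∈ T then q i else p i := by
        funext i
        by_cases hi : cls i = c
        · simp [glue, coords, hi, hc]
        · simp [glue, hi, y]
      have h2 : glue (coords cls c q) y = fun i => if cls i ∈ insert c T then q i else p i := by
        funext i
        by_cases hi : cls i = c
        · simp [glue, coords, hi]
        · simp [glue, hi, y]
      have hy : y ∈ fiberOver C S c (coords cls c p) := by
        refine ⟨fun b => ?_, by rw [h1]; exact ih⟩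
        by_cases hb : cls b ∈ T
        · simp only [y, hb, if_true]; exact hq b
        · simp only [y, hb, if_false]; exact hp b
      rw [h c] at hy
      exact h2 ▸ hy.2
  simpa using key Finset.univ

variable [Finite ι] [Finite κ] {C : ι → Set M}

theorem finite_fiberOver {c : κ}
    (horth : OrthogonalBoxes L (fun a : {i // cls i = c} => C a) (fun b : {i // cls i ≠ c} => C b))
    {S : Set (ι → M)} (hS : IsDef L S) :
    (fiberOver C S c '' {x : {i // cls i = c} → M | ∀ a : {i // cls i = c}, x a ∈ C a}).Finite := by
  have : DTup L S := ⟨hS⟩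
  exact horth (fun x y => glue x y ∈ S) inferInstance

/-- A set of coordinate tuples that is described by their fibres is definable. -/
theorem isDef_of_fiberOver (hC : ∀ i, DSet L (C i)) {c : κ}
    (horth : OrthogonalBoxes L (fun a : {i // cls i = c} => C a) (fun b : {i // cls i ≠ c} => C b))
    {S : Set (ι → M)} (hS : IsDef L S) (𝒮 : Set (Set ({i // cls i ≠ c} → M))) :
    IsDef L {x : {i // cls i = c} → M |
      (∀ a : {i // cls i = c}, x a ∈ C a) ∧ fiberOver C S c x ∈ 𝒮} := by
  have : DTup L S := ⟨hS⟩
  have hfin := (finite_fiberOver horth hS).subset (inter_subset_left (t := 𝒮))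
  have := hfin.to_subtype
  have h : ∀ k : ↥(fiberOver C S c ''
      {x : {i // cls i = c} → M | ∀ a : {i // cls i = c}, x a ∈ C a} ∩ 𝒮),
      IsDef L {x : {i // cls i = c} → M |
        (∀ a : {i // cls i = c}, x a ∈ C a) ∧ fiberOver C S c x = k} := by
    rintro ⟨_, ⟨x₀, hx₀, rfl⟩, -⟩
    have h1 : DPred L (fun x : {i // cls i = c} → M => (∀ a : {i // cls i = c}, x a ∈ C a) ∧
      ∀ y : {i // cls i ≠ c} → M, (∀ b : {i // cls i ≠ c}, y b ∈ C b) →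
        (glue x y ∈ S ↔ glue x₀ y ∈ S)) :=
      inferInstance
    convert! h1.isDef using 5 with x
    rw [Set.ext_iff]
    exact forall_congr' fun y => and_congr_right_iff
  have hU := Set.definable_iUnion_of_finite h
  convert! hU using 1
  ext x
  simp only [mem_ofPred_eq, mem_iUnion, Subtype.exists, exists_prop]
  constructor
  · rintro ⟨hx, h𝒮⟩
    exact ⟨_, ⟨⟨x, hx, rfl⟩, h𝒮⟩, hx, rfl⟩
  · rintro ⟨k, ⟨-, hk⟩, hx, rfl⟩
    exact ⟨hx, hk⟩

theorem IsDef.preimage_coords {c : κ} {A : Set ({i // cls i = c} → M)} (hA : IsDef L A) :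
    IsDef L (coords cls c ⁻¹' A) :=
  Set.Definable.preimage_comp (fun i : {i // cls i = c} => (i : ι)) hA

variable [TopologicalSpace M]

theorem continuous_coords (c : κ) : Continuous (coords cls c : (ι → M) → _) := by
  unfold coords; fun_prop

theorem DefSep.preimage_coords {c : κ} {A B : Set ({i // cls i = c} → M)} (h : DefSep L A B) :
    DefSep L (coords cls c ⁻¹' A) (coords cls c ⁻¹' B) := by
  obtain ⟨O₁, O₂, h1, h2, h3, h4, h5, h6, h7⟩ := h
  exact ⟨_, _, h1.preimage_coords, h2.preimage_coords, h3.preimage (continuous_coords c),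
    h4.preimage (continuous_coords c), h5.preimage _, preimage_mono h6, preimage_mono h7⟩

theorem DefSep.mono {α : Type} {A B A' B' : Set (α → M)} (h : DefSep L A B) (hA : A' ⊆ A)
    (hB : B' ⊆ B) : DefSep L A' B' := by
  obtain ⟨O₁, O₂, h1, h2, h3, h4, h5, h6, h7⟩ := h
  exact ⟨O₁, O₂, h1, h2, h3, h4, h5, hA.trans h6, hB.trans h7⟩

theorem DefSep.symm {α : Type} {A B : Set (α → M)} (h : DefSep L A B) : DefSep L B A := by
  obtain ⟨O₁, O₂, h1, h2, h3, h4, h5, h6, h7⟩ := h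
  exact ⟨O₂, O₁, h2, h1, h4, h3, h5.symm, h7, h6⟩

theorem defSep_sUnion_right {α : Type} {A : Set (α → M)} {ℬ : Set (Set (α → M))} (hℬ : ℬ.Finite)
    (h : ∀ B ∈ ℬ, DefSep L A B) : DefSep L A (⋃₀ ℬ) := by
  induction ℬ, hℬ using Set.Finite.induction_on with
  | empty => exact ⟨univ, ∅, by simp [IsDef], by simp [IsDef], isOpen_univ, isOpen_empty, by simp,
      subset_univ _, by simp⟩
  | insert _ _ ih =>
    rename_i B ℬ _ _
    obtain ⟨O₁, O₂, h1, h2, h3, h4, h5, h6, h7⟩ := h B (mem_insert _ _)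
    obtain ⟨P₁, P₂, k1, k2, k3, k4, k5, k6, k7⟩ := ih fun B hB => h B (mem_insert_of_mem _ hB)
    refine ⟨O₁ ∩ P₁, O₂ ∪ P₂, Set.Definable.inter h1 k1, Set.Definable.union h2 k2, h3.inter k3,
      h4.union k4, ?_, subset_inter h6 k6, ?_⟩
    · exact disjoint_union_right.2
        ⟨h5.mono_left inter_subset_left, k5.mono_left inter_subset_right⟩
    · rw [sUnion_insert]
      exact union_subset_union h7 k7

theorem defSep_sUnion {α : Type} {𝒜 ℬ : Set (Set (α → M))} (h𝒜 : 𝒜.Finite) (hℬ : ℬ.Finite)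
    (h : ∀ A ∈ 𝒜, ∀ B ∈ ℬ, DefSep L A B) : DefSep L (⋃₀ 𝒜) (⋃₀ ℬ) :=
  defSep_sUnion_right hℬ fun B hB =>
    (defSep_sUnion_right h𝒜 fun A hA => (h A hA B hB).symm).symm

variable [LinearOrder M] [DenselyOrdered M] [NoMinOrder M] [NoMaxOrder M] [OrderTopology M]
  [Tame L M]

/-- The points of `V` whose coordinates in each class lie in the closure of the set of those with
the same fibre in `Z` as the coordinates of `p`. -/
def closedRect (cls : ι → κ) (C : ι → Set M) (V Z : Set (ι → M)) (p : ι → M) : Set (ι → M) :=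
  {q | q ∈ V ∧ ∀ c, coords cls c q ∈ closure {x | (∀ a : {i // cls i = c}, x a ∈ C a) ∧
    fiberOver C Z c x = fiberOver C Z c (coords cls c p)}}

theorem closedRect_subset {V Z : Set (ι → M)} {p : ι → M} (hZ : V ∩ closure Z ⊆ Z)
    (hpC : ∀ i, p i ∈ C i) (hp : p ∈ Z) : closedRect cls C V Z p ⊆ Z := by
  rintro q ⟨hqV, hq⟩
  refine hZ ⟨hqV, mem_closure_iff_nhds.2 fun W hW => ?_⟩
  obtain ⟨l, u, hlu, hsub⟩ := mem_nhds_pi_iff_box.1 hW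
  have h : ∀ c, ∃ x : {i // cls i = c} → M,
      (∀ a : {i // cls i = c}, l a < x a ∧ x a < u a) ∧ (∀ a : {i // cls i = c}, x a ∈ C a) ∧
      fiberOver C Z c x = fiberOver C Z c (coords cls c p) := by
    intro c
    have hN : {x : {i // cls i = c} → M | ∀ a : {i // cls i = c}, l a < x a ∧ x a < u a} ∈
        𝓝 (coords cls c q) :=
      mem_nhds_pi_iff_box.2 ⟨fun a => l a, fun a => u a, fun a => hlu a, fun x hx => hx⟩
    obtain ⟨x, hx1, hx2⟩ := mem_closure_iff_nhds.1 (hq c) _ hN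
    exact ⟨x, hx1, hx2⟩
  choose x hx hxC hxf using h
  refine ⟨assemble x, hsub _ fun i => hx (cls i) ⟨i, rfl⟩, ?_⟩
  exact mem_of_fiberOver_eq (cls := cls) hpC (fun i => hxC (cls i) ⟨i, rfl⟩)
    (fun c => by rw [coords_assemble, hxf]) hp

theorem finite_closedRect
    (horth : ∀ c : κ, OrthogonalBoxes L (fun a : {i // cls i = c} => C a)
      (fun b : {i // cls i ≠ c} => C b))
    {V Z : Set (ι → M)} (hZ : IsDef L Z) (hZC : ∀ p ∈ Z, ∀ i, p i ∈ C i) :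
    (closedRect cls C V Z '' Z).Finite := by
  refine Set.Finite.image_of_factor (κ := fun p => fun c => fiberOver C Z c (coords cls c p)) ?_ ?_
  · refine (Set.Finite.pi fun c => finite_fiberOver (horth c) hZ).subset ?_
    rintro _ ⟨p, hp, rfl⟩ c -
    exact ⟨coords cls c p, fun a => hZC p hp a, rfl⟩
  · intro p _ q _ h
    simp only [closedRect, fun c => congrFun h c]

/-- Definable separation in a product of sets, one for each class of coordinates, when each class
has a scale and the classes are orthogonal.  Closed definable sets are finite unions of products of
closed sets, and disjoint products are disjoint in one of the factors. -/
theorem defSep_of_factors (hC : ∀ i, DSet L (C i)) (hCo : ∀ i, IsOpen (C i))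
    (hscale : ∀ c : κ, ∃ z, ∀ i, cls i = c → ∃ B, IsScale L (C i) z B)
    (horth : ∀ c : κ, OrthogonalBoxes L (fun a : {i // cls i = c} => C a)
      (fun b : {i // cls i ≠ c} => C b))
    {W : ∀ c : κ, Set ({i // cls i = c} → M)} (hW : ∀ c, IsDef L (W c))
    (hWC : ∀ c, ∀ x ∈ W c, ∀ a : {i // cls i = c}, x a ∈ C a) {V : Set (ι → M)}
    (hV : V = {p | ∀ c, coords cls c p ∈ W c}) {Z₁ Z₂ : Set (ι → M)}
    (hZ₁V : Z₁ ⊆ V) (hZ₂V : Z₂ ⊆ V) (hZ₁ : IsDef L Z₁) (hZ₂ : IsDef L Z₂)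
    (hZ₁c : V ∩ closure Z₁ ⊆ Z₁) (hZ₂c : V ∩ closure Z₂ ⊆ Z₂) (hdisj : Disjoint Z₁ Z₂) :
    DefSep L Z₁ Z₂ := by
  have hVC : ∀ p ∈ V, ∀ i, p i ∈ C i := by
    intro p hp i
    rw [hV] at hp
    exact hWC _ _ (hp (cls i)) ⟨i, rfl⟩
  have hcover : ∀ Z : Set (ι → M), Z ⊆ V → Z ⊆ ⋃₀ (closedRect cls C V Z '' Z) := by
    intro Z hZ p hp
    exact ⟨_, ⟨p, hp, rfl⟩, hZ hp, fun c => subset_closure ⟨fun a => hVC p (hZ hp) a, rfl⟩⟩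
  refine (defSep_sUnion
    (finite_closedRect (V := V) horth hZ₁ fun p hp => hVC p (hZ₁V hp))
    (finite_closedRect (V := V) horth hZ₂ fun p hp => hVC p (hZ₂V hp)) ?_).mono
    (hcover Z₁ hZ₁V) (hcover Z₂ hZ₂V)
  rintro _ ⟨p, hp, rfl⟩ _ ⟨q, hq, rfl⟩
  let K : Set (ι → M) → (ι → M) → ∀ c, Set ({i // cls i = c} → M) := fun Z p c =>
    {x | (∀ a : {i // cls i = c}, x a ∈ C a) ∧ fiberOver C Z c x = fiberOver C Z c (coords cls c p)}
  have hKdef : ∀ Z p c, IsDef L Z → IsDef L (K Z p c) := fun Z p c hZ =>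
    isDef_of_fiberOver hC (horth c) hZ {fiberOver C Z c (coords cls c p)}
  obtain ⟨c, hc⟩ : ∃ c, Disjoint (W c ∩ closure (K Z₁ p c)) (W c ∩ closure (K Z₂ q c)) := by
    by_contra! hcon
    choose x hx₁ hx₂ using fun c => not_disjoint_iff.1 (hcon c)
    have hxV : assemble x ∈ V := by
      rw [hV]
      exact fun c => by rw [coords_assemble]; exact (hx₁ c).1
    refine disjoint_left.1 hdisj
      (closedRect_subset (cls := cls) hZ₁c (hVC p (hZ₁V hp)) hp ⟨hxV, fun c => ?_⟩)
      (closedRect_subset (cls := cls) hZ₂c (hVC q (hZ₂V hq)) hq ⟨hxV, fun c => ?_⟩)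
    · rw [coords_assemble]; exact (hx₁ c).2
    · rw [coords_assemble]; exact (hx₂ c).2
  obtain ⟨z, hz⟩ := hscale c
  choose B hB using hz
  have hclosed : ∀ K : Set ({i // cls i = c} → M),
      W c ∩ closure (W c ∩ closure K) ⊆ W c ∩ closure K := fun K x hx =>
    ⟨hx.1, closure_minimal inter_subset_right isClosed_closure hx.2⟩
  have hsep := defSep_of_isScale (L := L) (C := fun a : {i // cls i = c} => C a) (z := z)
    (B := fun a => B a a.2) (V := W c) (fun a => hC a) (fun a => hCo a) (fun a => hB a a.2)
    (hWC c) inter_subset_left inter_subset_left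
    (Set.Definable.inter (hW c) (hKdef Z₁ p c hZ₁).closure)
    (Set.Definable.inter (hW c) (hKdef Z₂ q c hZ₂).closure)
    (hclosed _) (hclosed _) hc
  refine hsep.preimage_coords.mono ?_ ?_
  · rintro x ⟨hxV, hx⟩
    rw [hV] at hxV
    exact ⟨hxV c, hx c⟩
  · rintro x ⟨hxV, hx⟩
    rw [hV] at hxV
    exact ⟨hxV c, hx c⟩

/-- An open definable subset of the box is a finite union of products of open definable sets, one
for each class of coordinates: the factors are the interiors of the sets of coordinates whose fibre
belongs to a prescribed, finite set of fibres. -/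
theorem exists_finite_cover_by_factors (hC : ∀ i, DSet L (C i))
    (horth : ∀ c : κ, OrthogonalBoxes L (fun a : {i // cls i = c} => C a)
      (fun b : {i // cls i ≠ c} => C b))
    {U : Set (ι → M)} (hU : IsDef L U) (hUo : IsOpen U) (hUC : ∀ p ∈ U, ∀ i, p i ∈ C i) :
    ∃ 𝒱 : Set (Set (ι → M)), 𝒱.Finite ∧ U = ⋃₀ 𝒱 ∧ ∀ V ∈ 𝒱,
      ∃ W : ∀ c : κ, Set ({i // cls i = c} → M), (∀ c, IsDef L (W c)) ∧ (∀ c, IsOpen (W c)) ∧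
        (∀ c, ∀ x ∈ W c, ∀ a : {i // cls i = c}, x a ∈ C a) ∧
        V = {p | ∀ c, coords cls c p ∈ W c} := by
  let A : ∀ c : κ, Set (Set ({i // cls i ≠ c} → M)) → Set ({i // cls i = c} → M) := fun c 𝒮 =>
    {x | (∀ a : {i // cls i = c}, x a ∈ C a) ∧ fiberOver C U c x ∈ 𝒮}
  let K : ∀ c : κ, Set (Set ({i // cls i ≠ c} → M)) := fun c =>
    fiberOver C U c '' {x : {i // cls i = c} → M | ∀ a : {i // cls i = c}, x a ∈ C a}
  let P : (∀ c : κ, Set (Set ({i // cls i ≠ c} → M))) → Set (ι → M) := fun 𝒮 =>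
    {p | ∀ c, coords cls c p ∈ interior (A c (𝒮 c))}
  refine ⟨{V | V ∈ P '' univ.pi (fun c => 𝒫 K c) ∧ V ⊆ U}, ?_, ?_, ?_⟩
  · exact (((Set.Finite.pi fun c => (finite_fiberOver (horth c) hU).powerset).image P)).subset
      fun V hV => hV.1
  · refine Subset.antisymm (fun p hp => ?_) (sUnion_subset fun V hV => hV.2)
    obtain ⟨l, u, hlu, hsub⟩ := mem_nhds_pi_iff_box.1 (hUo.mem_nhds hp)
    let N : ∀ c : κ, Set ({i // cls i = c} → M) := fun c =>
      {x | ∀ a : {i // cls i = c}, l a < x a ∧ x a < u a}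
    have hNC : ∀ c, ∀ x ∈ N c, ∀ a : {i // cls i = c}, x a ∈ C a := by
      intro c x hx a
      have hmem : glue x (fun b => p b) ∈ U := hsub _ fun i => by
        by_cases hi : cls i = c
        · simpa [glue, hi] using hx ⟨i, hi⟩
        · simpa [glue, hi] using hlu i
      have := hUC _ hmem a
      simpa [glue, a.2] using this
    -- A box around `p` inside `U` is a product, and any point whose coordinate parts all have the
    -- fibres of parts of points of this box lies in `U`.
    refine ⟨P fun c => fiberOver C U c '' N c, ⟨⟨_, fun c _ => ?_, rfl⟩, ?_⟩, fun c => ?_⟩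
    · exact image_mono (hNC c)
    · intro q hq
      have hq' : ∀ c, coords cls c q ∈ A c (fiberOver C U c '' N c) :=
        fun c => interior_subset (hq c)
      choose hqC x hx hxf using hq'
      have hxU : assemble x ∈ U := hsub _ fun i => hx (cls i) ⟨i, rfl⟩
      exact mem_of_fiberOver_eq (cls := cls) (hUC _ hxU) (fun i => hqC (cls i) ⟨i, rfl⟩)
        (fun c => by rw [coords_assemble, hxf]) hxU
    · rw [mem_interior_iff_mem_nhds]
      refine mem_nhds_pi_iff_box.2 ⟨fun a => l a, fun a => u a, fun a => hlu a, fun x hx => ?_⟩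
      exact ⟨hNC c x hx, x, hx, rfl⟩
  · rintro _ ⟨⟨𝒮, -, rfl⟩, -⟩
    exact ⟨fun c => interior (A c (𝒮 c)),
      fun c => (isDef_of_fiberOver hC (horth c) hU (𝒮 c)).interior, fun c => isOpen_interior,
      fun c x hx => (interior_subset hx : x ∈ A c (𝒮 c)).1, rfl⟩

end Factors

/-! ### The concatenated domain -/

section Concat

variable {L : FirstOrder.Language.{u, v}} {M : Type w} [L.Structure M] [LinearOrder M]
  [DenselyOrdered M] [NoMinOrder M] [NoMaxOrder M] [TopologicalSpace M] [OrderTopology M]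
  {m : ℕ} (J : Fin m → GroupInterval M)

/-- The inclusion of the `i`-th group-interval in the concatenated domain. -/
def concatIncl (i : Fin m) (x : (J i).carrier) : ConcatDomain J :=
  ⟨toLex (i, ((x : M) : WithBot M)), .inr ⟨x, x.2, rfl⟩⟩

theorem isEmbedding_concatIncl (i : Fin m) : IsEmbedding (concatIncl J i) := by
  have : (J i).carrier.OrdConnected := GroupInterval.ordConnected_carrier
  have hmono : StrictMono (concatIncl J i) := by
    intro x y hxy
    exact (Prod.Lex.toLex_lt_toLex).2 (.inr ⟨rfl, WithBot.coe_lt_coe.2 hxy⟩)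
  refine hmono.isEmbedding_of_ordConnected ⟨?_⟩
  rintro _ ⟨x, rfl⟩ _ ⟨y, rfl⟩ ⟨⟨c, t⟩, hz⟩ ⟨h1, h2⟩
  have h1' : toLex (i, ((x : M) : WithBot M)) ≤ toLex (c, t) := h1
  have h2' : toLex (c, t) ≤ toLex (i, ((y : M) : WithBot M)) := h2
  rw [Prod.Lex.toLex_le_toLex] at h1' h2'
  have hc : c = i := by
    refine le_antisymm ?_ ?_
    · rcases h2' with h | h
      · exact h.le
      · exact h.1.le
    · rcases h1' with h | h
      · exact h.le
      · exact h.1.le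
  subst hc
  have hxt : ((x : M) : WithBot M) ≤ t := by
    rcases h1' with h | h
    · exact absurd h (lt_irrefl _)
    · exact h.2
  rcases hz with hz | ⟨w, hw, hwt⟩
  · have : t = ⊥ := hz.1
    rw [this] at hxt
    exact absurd (le_bot_iff.1 hxt) (WithBot.coe_ne_bot)
  · have ht : t = w := hwt
    subst ht
    exact ⟨⟨w, hw⟩, rfl⟩

variable {J}

/-- The embedding of a subset of the product in the power of the concatenated domain. -/
def concatEmb {V : Set (Fin m → M)} (hV : V ⊆ productBox J) (p : V) : Fin m → ConcatDomain J :=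
  fun i => concatIncl J i ⟨p.1 i, hV p.2 i⟩

theorem isEmbedding_concatEmb {V : Set (Fin m → M)} (hV : V ⊆ productBox J) :
    IsEmbedding (concatEmb hV) := by
  have h1 : IsEmbedding (Pi.map (concatIncl J)) := IsEmbedding.piMap (isEmbedding_concatIncl J)
  have h2 : IsEmbedding (fun (p : V) (i : Fin m) => (⟨p.1 i, hV p.2 i⟩ : (J i).carrier)) := by
    refine IsEmbedding.of_comp (continuous_pi fun i =>
      Continuous.subtype_mk ((continuous_apply i).comp continuous_subtype_val) _)
      (g := Pi.map (fun i => (Subtype.val : (J i).carrier → M)))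
      (Continuous.piMap fun i => continuous_subtype_val) ?_
    exact IsEmbedding.subtypeVal
  exact h1.comp h2

theorem concatEmb_mem {V W : Set (Fin m → M)} (hV : V ⊆ productBox J) (p : V) :
    concatEmb hV p ∈ toConcat J W ↔ p.1 ∈ W := by
  constructor
  · rintro ⟨q, hq, h⟩
    have : p.1 = q := by
      funext i
      have := congrArg (fun t => (ofLex t).2) (h i)
      exact WithBot.coe_injective this
    exact this ▸ hq
  · exact fun h => ⟨p.1, h, fun i => rfl⟩

/-- The image of the embedding is the copy of `V` in the power of the concatenated domain. -/
theorem exists_eq_concatEmb {V : Set (Fin m → M)} (hV : V ⊆ productBox J)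
    {x : Fin m → ConcatDomain J} (hx : x ∈ toConcat J V) : ∃ p : V, concatEmb hV p = x := by
  obtain ⟨p, hp, h⟩ := hx
  exact ⟨⟨p, hp⟩, funext fun i => Subtype.ext (h i).symm⟩

theorem IsDef.toConcat {W : Set (Fin m → M)} (hW : IsDef L W) (hWJ : W ⊆ productBox J) :
    ConcatDefinable L J (toConcat J W) := by
  intro s C
  -- A tuple of `toConcat J W` has its `j`-th coordinate in the copy of the `j`-th interval.
  by_cases h : s = id ∧ C = ∅
  · obtain ⟨rfl, rfl⟩ := h
    convert hW using 1
    ext p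
    constructor
    · rintro ⟨x, ⟨q, hq, hxq⟩, hxp⟩
      have : p = q := by
        funext j
        have := congrArg (fun t => (ofLex t).2) ((hxp j).symm.trans (hxq j))
        exact WithBot.coe_injective (by simpa using this)
      exact this ▸ hq
    · intro hp
      exact ⟨concatEmb hWJ ⟨p, hp⟩, (concatEmb_mem hWJ ⟨p, hp⟩).2 hp, fun j => by
        simp [concatEmb, concatIncl]⟩
  · suffices h0 : {p : Fin m → M | ∃ x ∈ _root_.toConcat J W, ∀ j,
        (x j).1 = toLex (s j, if j ∈ C then (⊥ : WithBot M) else (p j : WithBot M))} = ∅ by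
      rw [h0]; exact Set.definable_empty
    refine eq_empty_of_forall_notMem ?_
    rintro p ⟨x, ⟨q, -, hxq⟩, hxp⟩
    refine h ⟨funext fun j => ?_, Finset.eq_empty_of_forall_notMem fun j hj => ?_⟩
    · exact congrArg (fun t => (ofLex t).1) ((hxp j).symm.trans (hxq j))
    · have := congrArg (fun t => (ofLex t).2) ((hxq j).symm.trans (hxp j))
      simp [hj] at this

/-- Definable normality of a set in the structure of the concatenated domain, from separation of
definable subsets of the product. -/
theorem inducedDefinablyNormal_of_defSep {V : Set (Fin m → M)} (hV : V ⊆ productBox J)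
    (hVd : IsDef L V)
    (hsep : ∀ Z₁ Z₂ : Set (Fin m → M), Z₁ ⊆ V → Z₂ ⊆ V → IsDef L Z₁ → IsDef L Z₂ →
      V ∩ closure Z₁ ⊆ Z₁ → V ∩ closure Z₂ ⊆ Z₂ → Disjoint Z₁ Z₂ → DefSep L Z₁ Z₂) :
    InducedDefinablyNormal L J V := by
  intro Z₁ Z₂ hZ₁V hZ₂V hZ₁ hZ₂ hZ₁c hZ₂c hdisj
  have hemb := isEmbedding_concatEmb hV
  let e : V → toConcat J V := fun p => ⟨concatEmb hV p, (concatEmb_mem hV p).2 p.2⟩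
  have he : Continuous e := hemb.continuous.subtype_mk _
  -- The trace on `V` of a set of tuples of the concatenated domain.
  let T : Set (Fin m → ConcatDomain J) → Set (Fin m → M) := fun Z =>
    {p | ∃ x ∈ Z, ∀ j, (x j).1 = toLex (j, ((p j : M) : WithBot M))}
  have hTmem : ∀ Z (p : V), p.1 ∈ T Z ↔ concatEmb hV p ∈ Z := by
    intro Z p
    constructor
    · rintro ⟨x, hx, h⟩
      have : concatEmb hV p = x := funext fun j => Subtype.ext (h j).symm
      exact this ▸ hx
    · exact fun h => ⟨_, h, fun j => rfl⟩
  have hTV : ∀ Z, Z ⊆ toConcat J V → T Z ⊆ V := by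
    rintro Z hZ p ⟨x, hx, h⟩
    obtain ⟨q, hq, hxq⟩ := hZ hx
    have : p = q := by
      funext j
      exact WithBot.coe_injective (congrArg (fun t => (ofLex t).2) ((h j).symm.trans (hxq j)))
    exact this ▸ hq
  have hTd : ∀ Z, ConcatDefinable L J Z → IsDef L (T Z) := by
    intro Z hZ
    have := hZ id ∅
    simpa [T] using this
  have hTc : ∀ Z, Z ⊆ toConcat J V → IsClosed ((↑) ⁻¹' Z : Set (toConcat J V)) →
      V ∩ closure (T Z) ⊆ T Z := by
    intro Z hZ hc
    have h1 : IsClosed ((↑) ⁻¹' T Z : Set V) := by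
      have h2 := hc.preimage he
      have h3 : ((↑) ⁻¹' T Z : Set V) = e ⁻¹' ((↑) ⁻¹' Z) := Set.ext fun p => hTmem Z p
      rwa [h3]
    have := isClosed_preimage_val.1 h1
    rwa [inter_eq_right.2 (hTV Z hZ)] at this
  obtain ⟨O₁, O₂, hO₁, hO₂, hO₁o, hO₂o, hO, hZO₁, hZO₂⟩ := hsep (T Z₁) (T Z₂) (hTV _ hZ₁V)
    (hTV _ hZ₂V) (hTd _ hZ₁) (hTd _ hZ₂) (hTc _ hZ₁V hZ₁c) (hTc _ hZ₂V hZ₂c) (by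
      rw [Set.disjoint_left] at hdisj ⊢
      intro p h1 h2
      exact hdisj ((hTmem Z₁ ⟨p, hTV _ hZ₁V h1⟩).1 h1) ((hTmem Z₂ ⟨p, hTV _ hZ₁V h1⟩).1 h2))
  have hsub : ∀ O, toConcat J (O ∩ V) ⊆ toConcat J V := fun O x ⟨p, hp, h⟩ => ⟨p, hp.2, h⟩
  have hdef : ∀ O, IsDef L O → ConcatDefinable L J (toConcat J (O ∩ V)) := fun O h =>
    IsDef.toConcat (Set.Definable.inter h hVd) (inter_subset_right.trans hV)
  have hopen : ∀ O, IsOpen O → IsOpen ((↑) ⁻¹' toConcat J (O ∩ V) : Set (toConcat J V)) := by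
    intro O hOo
    obtain ⟨O', hO'o, hO'⟩ := hemb.isInducing.isOpen_iff.1 (hOo.preimage continuous_subtype_val)
    convert hO'o.preimage (continuous_subtype_val (p := (· ∈ toConcat J V))) using 1
    ext ⟨x, hx⟩
    obtain ⟨p, rfl⟩ := exists_eq_concatEmb hV hx
    have h1 : concatEmb hV p ∈ O' ↔ p.1 ∈ O := by
      rw [← Set.mem_preimage, hO']; exact Iff.rfl
    exact (concatEmb_mem hV p).trans ⟨fun h => h1.2 h.1, fun h => ⟨h1.1 h, p.2⟩⟩
  have hcov : ∀ Z O, Z ⊆ toConcat J V → T Z ⊆ O → Z ⊆ toConcat J (O ∩ V) := by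
    intro Z O hZ hZO x hx
    obtain ⟨p, rfl⟩ := exists_eq_concatEmb hV (hZ hx)
    exact (concatEmb_mem hV p).2 ⟨hZO ((hTmem Z p).2 hx), p.2⟩
  refine ⟨_, _, hsub O₁, hsub O₂, hdef O₁ hO₁, hdef O₂ hO₂, hopen O₁ hO₁o, hopen O₂ hO₂o, ?_,
    hcov Z₁ O₁ hZ₁V hZO₁, hcov Z₂ O₂ hZ₂V hZO₂⟩
  rw [Set.disjoint_left] at hO ⊢
  intro x h1 h2
  obtain ⟨p, rfl⟩ := exists_eq_concatEmb hV (hsub O₁ h1)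
  exact hO ((concatEmb_mem hV p).1 h1).1 ((concatEmb_mem hV p).1 h2).1

end Concat

/-! ### The decomposition -/

theorem mainTheorem8 (L : FirstOrder.Language.{u, v}) [L.IsOrdered]
    (M : Type w) [LinearOrder M] [DenselyOrdered M] [NoMinOrder M] [NoMaxOrder M] [Nonempty M]
    [TopologicalSpace M] [OrderTopology M] [L.Structure M] [L.OrderedStructure M]
    (hM : IsOMinimal L M)
    (m : ℕ) (J : Fin m → GroupInterval M) (hJ : ∀ i, (J i).IsDefinable L)
    (U : Set (Fin m → M)) (hUJ : U ⊆ productBox J) (hUdef : IsDef L U) (hUopen : IsOpen U) :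
    ∃ (n : ℕ) (V : Fin n → Set (Fin m → M)),
      (∀ k, V k ⊆ productBox J ∧ IsDef L (V k) ∧ IsOpen (V k) ∧
        InducedDefinablyNormal L J (V k)) ∧
      U = ⋃ k, V k := by
  have := hM.tame
  -- Intervals are put in one class when the right germs at their zeros correspond.
  let S : Setoid (Fin m) := ⟨fun i j => GermEquiv L (J i).zero (J j).zero,
    fun i => .refl L _, fun h => h.symm, fun h h' => h.trans h'⟩
  let cls : Fin m → Quotient S := Quotient.mk S
  have hI : ∀ i, IsDefInterval L (J i).carrier := fun i => (J i).isDefInterval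
  have hC : ∀ i, DSet L (J i).carrier := fun i => (hI i).isDef
  have horth : ∀ c, OrthogonalBoxes L (fun a : {i // cls i = c} => (J a).carrier)
      (fun b : {i // cls i ≠ c} => (J b).carrier) := by
    intro c
    refine orthogonalBoxes_of_orthogonal (fun a : {i // cls i = c} => hC a) _
      (fun b => hI b) fun a b => ?_
    refine (GroupInterval.hasInfiniteFibers_of_not_germEquiv (hJ b) (hJ a) fun h => ?_).orthogonal
      L (hI a) (hI b)
    exact b.2 ((Quotient.sound (s := S) h).trans a.2)
  have hscale : ∀ c, ∃ z : M, ∀ i, cls i = c → ∃ B, IsScale L (J i).carrier z B := by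
    intro c
    refine ⟨(J c.out).zero, fun i hi => ?_⟩
    have h : GermEquiv L (J c.out).zero (J i).zero :=
      Quotient.exact (s := S) ((Quotient.out_eq c).trans hi.symm)
    exact h.exists_isScale (GroupInterval.isScale (hJ i))
  obtain ⟨𝒱, hfin, hU𝒱, h𝒱⟩ := exists_finite_cover_by_factors (cls := cls) hC horth hUdef hUopen
    hUJ
  have key : ∀ V ∈ 𝒱, V ⊆ productBox J ∧ IsDef L V ∧ IsOpen V ∧ InducedDefinablyNormal L J V := by
    intro V hV
    obtain ⟨W, hWd, hWo, hWC, hVW⟩ := h𝒱 V hV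
    have hVJ : V ⊆ productBox J := by
      intro p hp i
      rw [hVW] at hp
      exact hWC (cls i) _ (hp (cls i)) ⟨i, rfl⟩
    have hVi : V = ⋂ c, coords cls c ⁻¹' W c := by
      rw [hVW]; ext p; simp
    have hVd : IsDef L V := by
      rw [hVi]
      exact Set.definable_iInter_of_finite fun c => (hWd c).preimage_coords
    have hVo : IsOpen V := by
      rw [hVi]
      exact isOpen_iInter_of_finite fun c => (hWo c).preimage (continuous_coords c)
    refine ⟨hVJ, hVd, hVo, inducedDefinablyNormal_of_defSep hVJ hVd ?_⟩
    intro Z₁ Z₂ h1 h2 h3 h4 h5 h6 h7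
    exact defSep_of_factors hC (fun i => (J i).isOpen_carrier) hscale horth hWd hWC hVW h1 h2 h3 h4
      h5 h6 h7
  have := hfin.to_subtype
  obtain ⟨n, ⟨e⟩⟩ := Finite.exists_equiv_fin 𝒱
  refine ⟨n, fun k => (e.symm k).1, fun k => key _ (e.symm k).2, ?_⟩
  rw [hU𝒱, sUnion_eq_iUnion]
  exact (e.symm.surjective.iUnion_comp fun V : 𝒱 => V.1).symm
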